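/- Let $\mathbb T$ be the unit circle with normalized Lebesgue measure, $L^2=L^2(\mathbb T)$, $H^2\subset L^2$ the Hardy space, and let $u$ be a nonconstant inner function. Let $K_u=H^2\ominus uH^2$, and let $P_u$ be the orthogonal projection of $L^2$ onto $K_u$. For $\Phi\in L^2$, the truncated Toeplitz operator with symbol $\Phi$ is $A_\Phi f=P_u(\Phi f)$, defined for the bounded functions $f\in K_u$; let $\mathcal T_u$ be the set of all bounded operators on $K_u$ that extend some $A_\Phi$, $\Phi\in L^2$ (such a $\Phi$ is called a symbol of the operator). Let $Cf=u\,\overline{zf}$ be the canonical conjugation on $K_u$ and $S_uf=P_u(zf)$ the compressed shift on $K_u$. For $\alpha\in\mathbb C$, let $\mathcal B_\alpha$ be the set of all operators in $\mathcal T_u$ that have a symbol of the form $\varphi+\alpha\,\overline{S_uC\varphi}+c$ with $\varphi\in K_u$, $c\in\mathbb C$; let $\mathcal B_\infty$ be the set of all operators in $\mathcal T_u$ that have an antiholomorphic symbol $\overline\psi$, $\psi\in H^2$. Theorem. (1) For every $\alpha\in\mathbb C\cup\{\infty\}$, $\mathcal B_\alpha$ is a commutative unital algebra of bounded operators on $K_u$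 that is closed in the weak operator topology and contained in $\mathcal T_u$. (2) Let $\mathcal A$ be an algebra (of bounded operators on $K_u$, unital or not) contained in $\mathcal T_u$. Then there exists $\alpha\in\mathbb C\cup\{\infty\}$ such that $\mathcal A\subseteq\mathcal B_\alpha$. (3) Consequently the algebras $\mathcal B_\alpha$ are exactly the maximal algebras contained in $\mathcal T_u$: an algebra $\mathcal A\subseteq\mathcal T_u$ is maximal with respect to inclusion among the algebras contained in $\mathcal T_u$ if and only if $\mathcal A=\mathcal B_\alpha$ for some $\alpha\in\mathbb C\cup\{\infty\}$. -/

import Mathlib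

open MeasureTheory AddCircle

noncomputable section

namespace TTO

/-! The unit circle is parametrized by `t ↦ exp (2 π i t)`, `t ∈ ℝ / ℤ`; the normalized Lebesgue
measure on the circle is then `haarAddCircle`, and the function `z ^ n` is `fourier n`. -/

/-- `L²` of the unit circle with normalized Lebesgue measure. -/
abbrev L2 : Type := Lp ℂ 2 (haarAddCircle : Measure UnitAddCircle)

/-- `L^∞` of the unit circle. -/
abbrev Linf : Type := Lp ℂ ⊤ (haarAddCircle : Measure UnitAddCircle)

/-- The coordinate function `z` on the circle, as an element of `L^∞`. -/
def z : Linf := fourierLp ⊤ 1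

lemma coeff_eq_inner (n : ℤ) (f : L2) :
    fourierCoeff (f : UnitAddCircle → ℂ) n = inner ℂ (fourierLp 2 n : L2) f := by
  rw [← fourierBasis_repr, HilbertBasis.repr_apply_apply, coe_fourierBasis]

/-- The Hardy space `H²`: all `f ∈ L²` whose negatively indexed Fourier coefficients vanish. -/
def H2 : Submodule ℂ L2 where
  carrier := {f | ∀ n : ℤ, n < 0 → fourierCoeff (f : UnitAddCircle → ℂ) n = 0}
  zero_mem' := by
    intro n _
    rw [coeff_eq_inner, inner_zero_right]
  add_mem' := by
    intro f g hf hg n hn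
    have h1 := hf n hn
    have h2 := hg n hn
    rw [coeff_eq_inner] at h1 h2 ⊢
    rw [inner_add_right, h1, h2, add_zero]
  smul_mem' := by
    intro c f hf n hn
    have h1 := hf n hn
    rw [coeff_eq_inner] at h1 ⊢
    rw [inner_smul_right, h1, mul_zero]

lemma isClosed_H2 : IsClosed (H2 : Set L2) := by
  have h : (H2 : Set L2) =
      ⋂ n : ℤ, ⋂ _ : n < 0, {f : L2 | inner ℂ (fourierLp 2 n : L2) f = 0} := by
    ext f
    simp only [Set.mem_iInter, Set.mem_ofPred_eq, ← coeff_eq_inner]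
    rfl
  rw [h]
  exact isClosed_iInter fun n => isClosed_iInter fun _ =>
    isClosed_eq (continuous_const.inner continuous_id) continuous_const

/-- Inner functions, through their boundary values: `u` is in `H^∞` and unimodular a.e. -/
structure IsInner (u : Linf) : Prop where
  coeff_eq_zero : ∀ n : ℤ, n < 0 → fourierCoeff (u : UnitAddCircle → ℂ) n = 0
  norm_eq_one : ∀ᵐ t ∂(haarAddCircle : Measure UnitAddCircle), ‖u t‖ = 1

/-- `u` is (a.e. equal to) a constant function. -/
def IsConstant (u : Linf) : Prop :=
  ∃ c : ℂ, ∀ᵐ t ∂(haarAddCircle : Measure UnitAddCircle), u t = c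

/-- The subspace `u H² = {u h : h ∈ H²}` of `L²`. -/
def uH2 (u : Linf) : Submodule ℂ L2 where
  carrier := {g | ∃ h ∈ H2, g = (u • h : L2)}
  zero_mem' := ⟨0, H2.zero_mem, (Lp.smul_zero ℂ 2 u).symm⟩
  add_mem' := by
    rintro _ _ ⟨h, hh, rfl⟩ ⟨k, hk, rfl⟩
    exact ⟨h + k, H2.add_mem hh hk, (Lp.add_smul u h k).symm⟩
  smul_mem' := by
    rintro c _ ⟨h, hh, rfl⟩
    exact ⟨c • h, H2.smul_mem c hh, Lp.smul_comm c u h⟩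

/-- The model space `K_u = H² ⊖ u H²`. -/
def modelSpace (u : Linf) : Submodule ℂ L2 := H2 ⊓ (uH2 u)ᗮ

instance (u : Linf) : CompleteSpace (modelSpace u) := by
  have h : IsClosed (modelSpace u : Set L2) :=
    isClosed_H2.inter (Submodule.isClosed_orthogonal (uH2 u))
  exact h.completeSpace_coe

/-- The orthogonal projection `P_u` of `L²` onto `K_u`. -/
def P (u : Linf) : L2 →L[ℂ] modelSpace u := (modelSpace u).orthogonalProjectionOnto

/-- The bounded operators on `K_u`. -/
abbrev Op (u : Linf) : Type := modelSpace u →L[ℂ] modelSpace u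

/-- `Φ ∈ L²` is a symbol of the bounded operator `A` on `K_u`, that is, `A` extends the truncated
Toeplitz operator `f ↦ P_u (Φ f)`, defined for the bounded functions `f` in `K_u`. Here `g` is the
function `f`, seen as an element of `L^∞`. -/
def HasSymbol (u : Linf) (A : Op u) (Φ : L2) : Prop :=
  ∀ (f : modelSpace u) (g : Linf),
    (g : UnitAddCircle → ℂ) =ᵐ[haarAddCircle] ((f : L2) : UnitAddCircle → ℂ) →
      A f = P u (g • Φ : L2)

/-- The set of all bounded truncated Toeplitz operators on `K_u`. -/
def boundedTTO (u : Linf) : Set (Op u) := {A | ∃ Φ : L2, HasSymbol u A Φ}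

/-- The conjugation `C f = u * conj (z f)`; it maps `K_u` to itself when `u` is inner. -/
def C (u : Linf) (f : L2) : L2 := u • star (z • f : L2)

/-- `S_u C φ`, where `S_u f = P_u (z f)` is the compressed shift on `K_u`. -/
def SC (u : Linf) (φ : modelSpace u) : modelSpace u := P u (z • C u φ : L2)

/-- The set `B_α`, `α` in the Riemann sphere, of all bounded truncated Toeplitz operators on `K_u`
of type `α`: those with a symbol `φ + α * conj (S_u C φ) + c`, where `φ ∈ K_u` and `c ∈ ℂ`, if
`α ∈ ℂ`, and those with an antiholomorphic symbol if `α = ∞`. -/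
def typeSet (u : Linf) : OnePoint ℂ → Set (Op u)
  | OnePoint.infty => {A | ∃ ψ ∈ H2, HasSymbol u A (star ψ)}
  | OnePoint.some α => {A | ∃ (φ : modelSpace u) (c : ℂ),
      HasSymbol u A ((φ : L2) + α • star (SC u φ : L2) + Lp.const 2 haarAddCircle c)}

end TTO

end

/-! Write `x ⊗ y` for `f ↦ ⟪y, f⟫ x`, let `k = P_u 1`, `w = u(0)`, `J = S C`. The whole argument
takes place in the defect `T - S T S*`. By Sarason's criterion (`hasSymbol_iff_hasDefect`) `T` is a
truncated Toeplitz operator exactly when its defect is `a ⊗ k + k ⊗ a'`, and a symbol `φ + ψ̄` gives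
`a = P_u φ`, `a' = P_u ψ`. Shifting a constant between `φ` and `ψ` changes `a` and `a'` by multiples
of `k`, so only their classes modulo `k` matter. Being of type `α` means `a' ≡ ᾱ J a`, and of type
`∞` means `a ≡ 0`.

Truncated Toeplitz operators also satisfy `C T C = T*`. This makes the commutator with `S` skew
under `C`, which forces `S T C k + w a ≡ J a'` (`HasDefect.hat_sub_mem`). Since `J` is an involution
modulo `k`, type `α` becomes `S T C k + w a ≡ α a`.

The heart is the product formula `HasDefect.mul`: modulo terms `p ⊗ k` and `k ⊗ q`, the defect of `A
B` is `a ⊗ b' - â ⊗ J b`, where `â = S A C k + w a`. It vanishes when `A` and `B` have the same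
type. Conversely, if `A²` is truncated Toeplitz then `A` has a type, and if `A B` is truncated
Toeplitz with `A` nontrivial of type `α`, then `B` has type `α`. Hence every algebra lies in one
`B_α`.

Type `α` is moreover equivalent to commuting with a rank one perturbation of a multiple of `S`. This
makes `B_α` closed under products and weakly closed. Commutativity of `B_α` follows because
symmetric operators with a symmetric product commute. The perturbed shift itself lies in `B_α`, and
testing against it rules out proper inclusions among the `B_α`, which gives maximality. -/

noncomputable section

namespace TTO

open scoped ComplexConjugate InnerProductSpace

/-! ### Multiplication operators and complex conjugation on `L²`. -/

section Multiplication

lemma ae_smul {p : ENNReal} (a : Linf) (x : Lp ℂ p (haarAddCircle : Measure UnitAddCircle)) :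
    ∀ᵐ t ∂(haarAddCircle : Measure UnitAddCircle),
      (a • x : Lp ℂ p (haarAddCircle : Measure UnitAddCircle)) t = a t * x t := by
  filter_upwards [Lp.coeFn_lpSMul (r := p) a x] with t ht
  simp [ht]

lemma ae_star {p : ENNReal} (x : Lp ℂ p (haarAddCircle : Measure UnitAddCircle)) :
    ∀ᵐ t ∂(haarAddCircle : Measure UnitAddCircle),
      (star x : Lp ℂ p (haarAddCircle : Measure UnitAddCircle)) t = conj (x t) := by
  filter_upwards [Lp.coeFn_star x] with t ht
  simp [ht]

/-- Multiplication by a bounded function, as an operator on `L²`. -/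
def M (a : Linf) : L2 →L[ℂ] L2 :=
  LinearMap.mkContinuous
    { toFun := fun x => a • x
      map_add' := fun x y => Lp.add_smul a x y
      map_smul' := fun c x => (Lp.smul_comm c a x).symm } ‖a‖ (fun x => Lp.norm_smul_le a x)

lemma M_apply (a : Linf) (x : L2) : M a x = (a • x : L2) := rfl

lemma ae_M (a : Linf) (x : L2) :
    ∀ᵐ t ∂(haarAddCircle : Measure UnitAddCircle), M a x t = a t * x t := ae_smul a x

lemma inner_congr {x y x' y' : L2}
    (h : ∀ᵐ t ∂(haarAddCircle : Measure UnitAddCircle),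
      conj (x t) * y t = conj (x' t) * y' t) : ⟪x, y⟫_ℂ = ⟪x', y'⟫_ℂ := by
  rw [L2.inner_def, L2.inner_def]
  refine integral_congr_ae ?_
  filter_upwards [h] with t ht
  simpa [mul_comm] using ht

lemma inner_M_left (a : Linf) (x y : L2) : ⟪M a x, y⟫_ℂ = ⟪x, M (star a) y⟫_ℂ := by
  refine inner_congr ?_
  filter_upwards [ae_M a x, ae_M (star a) y, ae_star a] with t h1 h2 h3
  rw [h1, h2, h3, map_mul]; ring

lemma M_comm (a b : Linf) (x : L2) : M a (M b x) = M b (M a x) := by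
  refine Lp.ext ?_
  filter_upwards [ae_M a (M b x), ae_M b x, ae_M b (M a x), ae_M a x] with t h1 h2 h3 h4
  rw [h1, h2, h3, h4]; ring

lemma M_smul (a b : Linf) (x : L2) : M (a • b : Linf) x = M a (M b x) := by
  refine Lp.ext ?_
  filter_upwards [ae_M a (M b x), ae_M b x, ae_M (a • b : Linf) x, ae_smul a b]
    with t h1 h2 h3 h4
  rw [h1, h2, h3, h4]; ring

lemma M_sub (a b : Linf) (x : L2) : M (a - b) x = M a x - M b x := by
  refine Lp.ext ?_
  filter_upwards [ae_M (a - b) x, ae_M a x, ae_M b x, Lp.coeFn_sub a b,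
    Lp.coeFn_sub (M a x) (M b x)] with t h1 h2 h3 h4 h5
  rw [h1, h5, h4, Pi.sub_apply, Pi.sub_apply, h2, h3]; ring

lemma M_const_smul (c : ℂ) (a : Linf) (x : L2) : M (c • a) x = c • M a x :=
  Lp.smul_assoc c a x

lemma M_star_M {a : Linf} (ha : ∀ᵐ t ∂(haarAddCircle : Measure UnitAddCircle), ‖a t‖ = 1)
    (x : L2) : M (star a) (M a x) = x := by
  refine Lp.ext ?_
  filter_upwards [ae_M (star a) (M a x), ae_M a x, ae_star a, ha] with t h1 h2 h3 h4
  rw [h1, h2, h3, ← mul_assoc, Complex.conj_mul', h4]; simp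

lemma M_M_star {a : Linf} (ha : ∀ᵐ t ∂(haarAddCircle : Measure UnitAddCircle), ‖a t‖ = 1)
    (x : L2) : M a (M (star a) x) = x := by rw [M_comm, M_star_M ha]

lemma star_M (a : Linf) (x : L2) : star (M a x) = M (star a) (star x) := by
  refine Lp.ext ?_
  filter_upwards [ae_star (M a x), ae_M a x, ae_M (star a) (star x), ae_star a, ae_star x]
    with t h1 h2 h3 h4 h5
  rw [h1, h2, h3, h4, h5, map_mul]

lemma inner_star_star (x y : L2) : ⟪star x, star y⟫_ℂ = ⟪y, x⟫_ℂ := by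
  refine inner_congr ?_
  filter_upwards [ae_star x, ae_star y] with t h1 h2
  rw [h1, h2, Complex.conj_conj, mul_comm]

lemma star_add_L2 (x y : L2) : star (x + y) = star x + star y := by
  refine Lp.ext ?_
  filter_upwards [ae_star (x + y), ae_star x, ae_star y, Lp.coeFn_add x y,
    Lp.coeFn_add (star x) (star y)] with t h1 h2 h3 h4 h5
  rw [h1, h5, h4, Pi.add_apply, Pi.add_apply, h2, h3, map_add]

lemma star_smul_L2 (c : ℂ) (x : L2) : star (c • x) = conj c • star x := by
  refine Lp.ext ?_
  filter_upwards [ae_star (c • x), ae_star x, Lp.coeFn_smul c x,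
    Lp.coeFn_smul (conj c) (star x)] with t h1 h2 h3 h4
  rw [h1, h4, h3, Pi.smul_apply, Pi.smul_apply, h2]; simp

end Multiplication

/-! ### Fourier coefficients and Parseval's identity. -/

section Fourier

/-- The function `z ^ n`, as an element of `L²`. -/
abbrev e (n : ℤ) : L2 := fourierLp 2 n

lemma M_z_e (n : ℤ) : M z (e n) = e (n + 1) := by
  refine Lp.ext ?_
  filter_upwards [ae_M z (e n), coeFn_fourierLp (T := 1) 2 n, coeFn_fourierLp (T := 1) 2 (n + 1),
    coeFn_fourierLp (T := 1) ⊤ 1] with t h1 h2 h3 h4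
  rw [h1, h2, h3, z, h4, add_comm, fourier_add]

lemma norm_z : ∀ᵐ t ∂(haarAddCircle : Measure UnitAddCircle), ‖z t‖ = 1 := by
  filter_upwards [coeFn_fourierLp (T := 1) ⊤ 1] with t h
  rw [z, h, fourier_apply, Circle.norm_coe]

lemma M_star_z_e (n : ℤ) : M (star z) (e n) = e (n - 1) := by
  rw [show e n = M z (e (n - 1)) by rw [M_z_e]; congr 1; ring, M_star_M norm_z]

lemma M_fourierLp_zero (x : L2) : M (fourierLp ⊤ 0) x = x := by
  refine Lp.ext ?_
  filter_upwards [ae_M (fourierLp ⊤ 0) x, coeFn_fourierLp (T := 1) ⊤ 0] with t h1 h2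
  rw [h1, h2, fourier_zero, one_mul]

lemma star_e (n : ℤ) : star (e n) = e (-n) := by
  refine Lp.ext ?_
  filter_upwards [ae_star (e n), coeFn_fourierLp (T := 1) 2 n,
    coeFn_fourierLp (T := 1) 2 (-n)] with t h1 h2 h3
  rw [h1, h2, h3, fourier_neg]

lemma const_eq_smul_e (c : ℂ) : Lp.const 2 haarAddCircle c = c • e 0 := by
  refine Lp.ext ?_
  filter_upwards [Lp.coeFn_const (p := 2) (μ := (haarAddCircle : Measure UnitAddCircle)) c,
    Lp.coeFn_smul c (e 0), coeFn_fourierLp (T := 1) 2 0] with t h1 h2 h3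
  rw [h1, h2, Pi.smul_apply, h3, fourier_zero]; simp

lemma M_e_zero_ae (a : Linf) :
    (M a (e 0) : UnitAddCircle → ℂ) =ᵐ[haarAddCircle] (a : UnitAddCircle → ℂ) := by
  filter_upwards [ae_M a (e 0), coeFn_fourierLp (T := 1) 2 0] with t h1 h2
  rw [h1, h2, fourier_zero, mul_one]

lemma ae_eq_iff_M_e_zero (a : Linf) (f : L2) :
    ((a : UnitAddCircle → ℂ) =ᵐ[haarAddCircle] (f : UnitAddCircle → ℂ)) ↔ M a (e 0) = f :=
  ⟨fun h => Lp.ext ((M_e_zero_ae a).trans h), fun h => h ▸ (M_e_zero_ae a).symm⟩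

lemma fourierCoeff_Linf (a : Linf) (n : ℤ) :
    fourierCoeff (a : UnitAddCircle → ℂ) n = ⟪e n, M a (e 0)⟫_ℂ := by
  rw [← coeff_eq_inner, fourierCoeff_congr_ae (M_e_zero_ae a)]

/-- For bounded `a`, `b`: `⟨b, a ȳ⟩ = ⟨b y, a⟩`. -/
lemma inner_M_star (a b : Linf) (y : L2) :
    ⟪M b (e 0), M a (star y)⟫_ℂ = ⟪M b y, M a (e 0)⟫_ℂ := by
  refine inner_congr ?_
  filter_upwards [M_e_zero_ae a, M_e_zero_ae b, ae_M a (star y), ae_M b y, ae_star y]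
    with t h1 h2 h3 h4 h5
  rw [h1, h2, h3, h4, h5, map_mul]; ring

/-- For bounded `a`, `b`: `⟨b, a y⟩ = ⟨b ȳ, a⟩`. -/
lemma inner_M_star' (a b : Linf) (y : L2) :
    ⟪M b (e 0), M a y⟫_ℂ = ⟪M b (star y), M a (e 0)⟫_ℂ := by
  rw [← inner_M_star, star_star]

lemma inner_e_M_z (n : ℤ) (x : L2) : ⟪e n, M z x⟫_ℂ = ⟪e (n - 1), x⟫_ℂ := by
  rw [← M_star_z_e, inner_M_left, star_star]

lemma inner_e_M_star_z (n : ℤ) (x : L2) : ⟪e n, M (star z) x⟫_ℂ = ⟪e (n + 1), x⟫_ℂ := by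
  rw [← M_z_e, inner_M_left]

lemma inner_e_star (n : ℤ) (x : L2) : ⟪e n, star x⟫_ℂ = conj ⟪e (-n), x⟫_ℂ := by
  rw [inner_conj_symm, ← inner_star_star, star_star, star_e]

lemma inner_e_e (m n : ℤ) : ⟪e m, e n⟫_ℂ = if m = n then 1 else 0 :=
  orthonormal_iff_ite.mp orthonormal_fourier m n

lemma inner_eq_zero_of_coeff {x y : L2} (h : ∀ n, ⟪e n, x⟫_ℂ = 0 ∨ ⟪e n, y⟫_ℂ = 0) :
    ⟪x, y⟫_ℂ = 0 := by
  rw [← (fourierBasis (T := 1)).tsum_inner_mul_inner x y]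
  refine (tsum_congr fun n => ?_).trans tsum_zero
  rw [coe_fourierBasis, ← inner_conj_symm]
  rcases h n with h | h <;> simp [h]

lemma eq_zero_of_coeff {x : L2} (h : ∀ n, ⟪e n, x⟫_ℂ = 0) : x = 0 :=
  inner_self_eq_zero.mp (inner_eq_zero_of_coeff fun n => Or.inl (h n))

lemma hasSum_norm_coeff (x : L2) : HasSum (fun n : ℤ => ‖⟪e n, x⟫_ℂ‖ ^ 2) (‖x‖ ^ 2) := by
  have h := hasSum_sq_fourierCoeff (T := 1) x
  simp only [coeff_eq_inner] at h
  have h2 : ‖x‖ ^ 2 = ∫ t : UnitAddCircle, ‖x t‖ ^ 2 ∂haarAddCircle := by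
    have h3 := inner_self_eq_norm_sq_to_K (𝕜 := ℂ) x
    rw [L2.inner_def] at h3
    have h4 : (∫ t : UnitAddCircle, ⟪x t, x t⟫_ℂ ∂haarAddCircle)
        = ((∫ t : UnitAddCircle, ‖x t‖ ^ 2 ∂haarAddCircle : ℝ) : ℂ) := by
      rw [← integral_complex_ofReal]
      congr 1
      ext t
      simp [inner_self_eq_norm_sq_to_K]
    rw [h4] at h3
    exact (Complex.ofReal_injective (by simpa using h3)).symm
  rw [h2]; exact h

end Fourier

/-! ### The Hardy space and multiplication by bounded analytic functions. -/

section Hardy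

lemma mem_H2_iff {x : L2} : x ∈ H2 ↔ ∀ n : ℤ, n < 0 → ⟪e n, x⟫_ℂ = 0 := by
  change (∀ n : ℤ, n < 0 → _) ↔ _
  simp only [coeff_eq_inner]

lemma e_mem_H2 {n : ℤ} (hn : 0 ≤ n) : e n ∈ H2 :=
  mem_H2_iff.mpr fun m hm => by rw [inner_e_e, if_neg (by omega)]

lemma inner_eq_zero_of_mem_H2 {x y : L2} (hx : ∀ n : ℤ, 0 ≤ n → ⟪e n, x⟫_ℂ = 0) (hy : y ∈ H2) :
    ⟪x, y⟫_ℂ = 0 :=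
  inner_eq_zero_of_coeff fun n => (le_or_gt 0 n).imp (hx n) (mem_H2_iff.mp hy n)

lemma mem_H2_orthogonal_iff {x : L2} : x ∈ H2ᗮ ↔ ∀ n : ℤ, 0 ≤ n → ⟪e n, x⟫_ℂ = 0 :=
  ⟨fun h n hn => h (e n) (e_mem_H2 hn), fun h y hy => by
    rw [← inner_conj_symm, inner_eq_zero_of_mem_H2 h hy, map_zero]⟩

instance : CompleteSpace H2 := isClosed_H2.completeSpace_coe

/-- The product of a bounded analytic function and a function in `H²` is in `H²`. -/
lemma M_mem_H2 {a : Linf} (ha : M a (e 0) ∈ H2) {x : L2} (hx : x ∈ H2) : M a x ∈ H2 := by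
  rw [mem_H2_iff] at ha ⊢
  intro n hn
  rw [← star_star a, ← inner_M_left]
  refine inner_eq_zero_of_mem_H2 (fun m hm => ?_) hx
  -- Moving powers of `z` across the inner product turns a coefficient of `ā zⁿ` at `m ≥ 0` into the
  -- conjugate of the coefficient of `a` at `n - m < 0`.
  have h : ∀ k : ℕ, ∀ b : Linf, ⟪e k, M b (e n)⟫_ℂ = ⟪e 0, M b (e (n - k))⟫_ℂ := by
    intro k b
    induction k generalizing n with
    | zero => simp
    | succ k ih =>
      push_cast
      rw [← M_z_e, inner_M_left, M_comm, M_star_z_e, ih (n - 1) (by omega)]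
      congr 3; ring
  obtain ⟨k, rfl⟩ := Int.eq_ofNat_of_zero_le hm
  rw [h, ← inner_conj_symm, inner_M_left, star_star,
    ha _ (by omega), map_zero]

lemma M_z_mem_H2 {x : L2} (hx : x ∈ H2) : M z x ∈ H2 :=
  M_mem_H2 (by rw [M_z_e]; exact e_mem_H2 (by norm_num)) hx

/-- Every `L²` function is the sum of an analytic and an antianalytic one. -/
lemma exists_analytic_add_antianalytic (Φ : L2) : ∃ φ ∈ H2, ∃ ψ ∈ H2, Φ = φ + star ψ := by
  obtain ⟨φ, hφ, y, hy, h⟩ := Submodule.exists_add_mem_mem_orthogonal (K := H2) Φ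
  refine ⟨φ, hφ, star y, mem_H2_iff.mpr fun n hn => ?_, by rw [star_star, h]⟩
  rw [inner_e_star, mem_H2_orthogonal_iff.mp hy (-n) (by omega), map_zero]

end Hardy

/-! ### Abstract compressed shifts. -/

/-- The structure carried by a model space: the compressed shift `S`, its adjoint `R`, a conjugation
`C` and the reproducing kernel `k` at the origin, where `w` is the value of the inner function at
the origin. -/
structure CompressedShift (K : Type*) [NormedAddCommGroup K] [InnerProductSpace ℂ K] where
  S : K →L[ℂ] K
  R : K →L[ℂ] K
  C : K →ₗ⋆[ℂ] K
  k : K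
  w : ℂ
  inner_R : ∀ f g, ⟪R f, g⟫_ℂ = ⟪f, S g⟫_ℂ
  C_C : ∀ f, C (C f) = f
  inner_C_C : ∀ f g, ⟪C f, C g⟫_ℂ = ⟪g, f⟫_ℂ
  C_S : ∀ f, C (S f) = R (C f)
  S_R : ∀ f, S (R f) = f - ⟪k, f⟫_ℂ • k
  R_k : R k = -(conj w • C k)
  k_ne : k ≠ 0
  cyclic : ∀ g, (∀ n : ℕ, ⟪k, R^[n] g⟫_ℂ = 0) → g = 0

namespace CompressedShift

variable {K : Type*} [NormedAddCommGroup K] [InnerProductSpace ℂ K] (X : CompressedShift K)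

lemma C_R (f : K) : X.C (X.R f) = X.S (X.C f) := by
  rw [← X.C_C (X.S (X.C f)), X.C_S, X.C_C]

lemma inner_C_left (f g : K) : ⟪X.C f, g⟫_ℂ = ⟪X.C g, f⟫_ℂ := by
  conv_lhs => rw [← X.C_C g]
  rw [X.inner_C_C]

lemma inner_C_right (f g : K) : ⟪f, X.C g⟫_ℂ = ⟪g, X.C f⟫_ℂ := by
  conv_lhs => rw [← X.C_C f]
  rw [X.inner_C_C]

lemma inner_R_right (f g : K) : ⟪f, X.R g⟫_ℂ = ⟪X.S f, g⟫_ℂ := by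
  rw [← inner_conj_symm, X.inner_R, inner_conj_symm]

lemma S_C_k : X.S (X.C X.k) = -(X.w • X.k) := by
  rw [← X.C_R, X.R_k, map_neg, map_smulₛₗ, X.C_C, Complex.conj_conj]

lemma R_S (f : K) : X.R (X.S f) = f - ⟪X.C X.k, f⟫_ℂ • X.C X.k := by
  have h : X.R (X.S f) = X.C (X.S (X.R (X.C f))) := by rw [X.C_S, X.C_R, X.C_C]
  rw [h, X.S_R, map_sub, X.C_C, map_smulₛₗ, inner_conj_symm, X.inner_C_left]

lemma inner_k_k_ne : ⟪X.k, X.k⟫_ℂ ≠ 0 := inner_self_ne_zero.mpr X.k_ne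

/-- Two evaluations of `S S* k` are compared: `k - ⟪k, k⟫ k`, and `|w|² k` from the action of `S*`
on `k` and of `S` on `C k`. -/
lemma inner_k_k : ⟪X.k, X.k⟫_ℂ = 1 - X.w * conj X.w := by
  have h := X.S_R X.k
  rw [X.R_k, map_neg, map_smul, X.S_C_k] at h
  have h2 : (1 - X.w * conj X.w - ⟪X.k, X.k⟫_ℂ) • X.k = 0 := by
    rw [sub_smul, sub_smul, one_smul, mul_comm, mul_smul]
    rw [sub_right_comm, ← h]; simp
  exact (sub_eq_zero.mp ((smul_eq_zero.mp h2).resolve_right X.k_ne)).symm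

lemma inner_k_S (f : K) : ⟪X.k, X.S f⟫_ℂ = -(X.w * ⟪X.C X.k, f⟫_ℂ) := by
  rw [← X.inner_R, X.R_k, inner_neg_left, inner_smul_left, Complex.conj_conj]

lemma inner_C_k_C_k : ⟪X.C X.k, X.C X.k⟫_ℂ = ⟪X.k, X.k⟫_ℂ := X.inner_C_C _ _

/-- The line spanned by the kernel at the origin. -/
abbrev line : Submodule ℂ K := Submodule.span ℂ {X.k}

lemma k_mem : X.k ∈ X.line := Submodule.mem_span_singleton_self _

lemma smul_k_mem (c : ℂ) : c • X.k ∈ X.line := X.line.smul_mem c X.k_mem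

lemma inner_eq_zero_of_mem_line {x f : K} (hx : x ∈ X.line) (hf : ⟪X.k, f⟫_ℂ = 0) :
    ⟪x, f⟫_ℂ = 0 := by
  obtain ⟨c, rfl⟩ := Submodule.mem_span_singleton.mp hx
  rw [inner_smul_left, hf, mul_zero]

/-- The component of a vector orthogonal to the kernel at the origin. -/
def perp (f : K) : K := f - (⟪X.k, f⟫_ℂ / ⟪X.k, X.k⟫_ℂ) • X.k

lemma inner_k_perp (f : K) : ⟪X.k, X.perp f⟫_ℂ = 0 := by
  rw [perp, inner_sub_right, inner_smul_right, div_mul_cancel₀ _ X.inner_k_k_ne, sub_self]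

lemma mem_line_of_inner {x : K} (h : ∀ f, ⟪X.k, f⟫_ℂ = 0 → ⟪x, f⟫_ℂ = 0) : x ∈ X.line := by
  have h1 : ⟪X.perp x, X.perp x⟫_ℂ = 0 := by
    conv_lhs => enter [2]; rw [perp]
    rw [inner_sub_left, inner_smul_left, X.inner_k_perp, mul_zero, sub_zero,
      h _ (X.inner_k_perp x)]
  have h2 := inner_self_eq_zero.mp h1
  rw [perp, sub_eq_zero] at h2
  exact h2 ▸ X.smul_k_mem _

/-- The antilinear map `f ↦ S C f`. -/
def J : K →ₗ⋆[ℂ] K := X.S.toLinearMap.comp X.C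

lemma J_apply (f : K) : X.J f = X.S (X.C f) := rfl

/-- This is what makes `J` an antilinear involution modulo `k`, so that membership in `line` can be
tested after applying `J`. -/
lemma J_J (f : K) : X.J (X.J f) = f - ⟪X.k, f⟫_ℂ • X.k := by
  rw [J_apply, J_apply, X.C_S, X.C_C, X.S_R]

lemma J_mem {f : K} (hf : f ∈ X.line) : X.J f ∈ X.line := by
  obtain ⟨c, rfl⟩ := Submodule.mem_span_singleton.mp hf
  rw [map_smulₛₗ, J_apply, X.S_C_k]
  exact X.line.smul_mem _ (X.line.neg_mem (X.smul_k_mem _))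

lemma J_mem_iff {f : K} : X.J f ∈ X.line ↔ f ∈ X.line := by
  refine ⟨fun h => ?_, X.J_mem⟩
  have h2 := X.J_mem h
  rw [J_J] at h2
  simpa using X.line.add_mem h2 (X.smul_k_mem ⟪X.k, f⟫_ℂ)

/-- `T - S T S* = a ⊗ k + k ⊗ a'`. -/
def HasDefect (T : K →L[ℂ] K) (a a' : K) : Prop :=
  ∀ f, T f - X.S (T (X.R f)) = ⟪X.k, f⟫_ℂ • a + ⟪a', f⟫_ℂ • X.k

/-- `C T C = T*`. -/
def IsSymm (T : K →L[ℂ] K) : Prop := ∀ f g, ⟪X.C (T (X.C f)), g⟫_ℂ = ⟪f, T g⟫_ℂ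

/-- The vector `S T C k + w a`. -/
def hat (T : K →L[ℂ] K) (a : K) : K := X.S (T (X.C X.k)) + X.w • a

/-! ### Defects, complex symmetry, and the defect of a product. -/

section Defect

variable {X}
variable {A B T L : K →L[ℂ] K} {a a' b b' : K}

/-- The defect identity evaluated at `S f`, with `S* S = 1 - C k ⊗ C k`, exhibits the commutator of
`T` and `S` as an operator of rank at most two. The vector `hat` collects everything paired with `C
k`. -/
lemma HasDefect.apply_S (h : X.HasDefect T a a') (f : K) :
    T (X.S f) = X.S (T f) - ⟪X.C X.k, f⟫_ℂ • X.hat T a + ⟪a', X.S f⟫_ℂ • X.k := by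
  have h1 := h (X.S f)
  rw [X.R_S, X.inner_k_S, map_sub, map_smul, map_sub, map_smul] at h1
  rw [sub_eq_iff_eq_add.mp h1, hat]
  module

lemma HasDefect.apply_k (h : X.HasDefect T a a') :
    T X.k = a - conj X.w • X.hat T a + ⟪a', X.k⟫_ℂ • X.k := by
  have h1 := h X.k
  rw [X.R_k, map_neg, map_smul, map_neg, map_smul, X.inner_k_k] at h1
  rw [sub_eq_iff_eq_add.mp h1, hat]
  module

lemma IsSymm.inner_comp (hT : X.IsSymm T) (hL : X.IsSymm L) (f g : K) :
    ⟪g, T (L f)⟫_ℂ = ⟪X.C f, L (T (X.C g))⟫_ℂ := by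
  rw [← hT, ← hL, X.C_C, X.inner_C_left]

lemma isSymm_S : X.IsSymm X.S := fun f g => by rw [X.C_S, X.C_C, X.inner_R]

/-- Conjugating by `C` takes adjoints and so reverses the order of products: commutators of
symmetric operators are skew under `C`. This is the source of both rigidity arguments below. -/
lemma IsSymm.commutator (hT : X.IsSymm T) (hL : X.IsSymm L) (f g : K) :
    ⟪g, T (L f) - L (T f)⟫_ℂ = -⟪X.C f, T (L (X.C g)) - L (T (X.C g))⟫_ℂ := by
  rw [inner_sub_right, inner_sub_right, hT.inner_comp hL f g, hL.inner_comp hT f g, neg_sub]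

lemma mul_apply (A B : K →L[ℂ] K) (f : K) : (A * B) f = A (B f) := rfl

/-- Symmetric operators with a symmetric product commute. -/
lemma IsSymm.commute (hA : X.IsSymm A) (hB : X.IsSymm B) (hAB : X.IsSymm (A * B)) :
    A * B = B * A := by
  ext f
  refine ext_inner_left ℂ fun g => ?_
  have h := hB.inner_comp hA f g
  rw [mul_apply, mul_apply, h]
  rw [← mul_apply A B f, ← hAB, X.inner_C_left,
    mul_apply]

/-- The commutator of `T` and `S` is `k ⊗ S* a' - hat ⊗ C k`. Skewness under `C` interchanges its
two terms, and evaluation at `C k` matches `hat` with `J a'` up to a multiple of `k`. -/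
lemma HasDefect.hat_sub_mem (h : X.HasDefect T a a') (hT : X.IsSymm T) :
    X.hat T a - X.J a' ∈ X.line := by
  have key : ∀ g, ⟪g, X.J a' - X.hat T a⟫_ℂ * ⟪X.k, X.k⟫_ℂ
      = ⟪g, X.k⟫_ℂ * (⟪X.k, X.hat T a⟫_ℂ - ⟪a', X.S (X.C X.k)⟫_ℂ) := by
    intro g
    have h1 := hT.commutator (isSymm_S (X := X)) (X.C X.k) g
    have h2 : ∀ f, T (X.S f) - X.S (T f)
        = ⟪a', X.S f⟫_ℂ • X.k - ⟪X.C X.k, f⟫_ℂ • X.hat T a := by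
      intro f; rw [h.apply_S]; module
    rw [h2, h2, X.C_C] at h1
    simp only [inner_sub_right, inner_smul_right, X.inner_C_C] at h1 ⊢
    rw [← X.inner_R a' (X.C g), X.inner_C_right, X.C_R] at h1
    rw [J_apply]
    linear_combination h1
  have h3 : X.J a' - X.hat T a = ((⟪X.k, X.hat T a⟫_ℂ - ⟪a', X.S (X.C X.k)⟫_ℂ) /
      ⟪X.k, X.k⟫_ℂ) • X.k := by
    refine ext_inner_left ℂ fun g => ?_
    rw [inner_smul_right, div_mul_eq_mul_div, eq_div_iff X.inner_k_k_ne, key, mul_comm]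
  rw [← neg_mem_iff, neg_sub, h3]
  exact X.smul_k_mem _

/-- The defect of a product, up to terms `p ⊗ k` and `k ⊗ q`. -/
lemma HasDefect.mul (hA : X.HasDefect A a a') (hB : X.HasDefect B b b')
    (sB : X.IsSymm B) :
    ∃ p q : K, ∀ f, (A * B) f - X.S ((A * B) (X.R f)) =
      ⟪b', f⟫_ℂ • a - ⟪X.J b, f⟫_ℂ • X.hat A a + ⟪X.k, f⟫_ℂ • p + ⟪q, f⟫_ℂ • X.k := by
  obtain ⟨c, hc⟩ := Submodule.mem_span_singleton.mp (hB.hat_sub_mem sB)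
  have hc' : X.hat B b = X.J b' + c • X.k := by rw [hc]; abel
  have h1 : ∃ d : ℂ, X.J (B X.k) = X.J b - X.w • b' + d • X.k := by
    rw [hB.apply_k, hc', map_add, map_sub, map_smulₛₗ, map_smulₛₗ, map_add, map_smulₛₗ, J_J,
      Complex.conj_conj, J_apply X X.k, X.S_C_k]
    exact ⟨X.w * ⟪X.k, b'⟫_ℂ + X.w * conj c * X.w - conj ⟪b', X.k⟫_ℂ * X.w, by module⟩
  obtain ⟨d, hd⟩ := h1
  -- Symmetry of `B` turns the left side into `⟪J (B k), f⟫`. Its `conj w` term cancels the one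
  -- coming from `A k` in the final computation.
  have h2 : ∀ f, ⟪X.C X.k, B (X.R f)⟫_ℂ
      = ⟪X.J b, f⟫_ℂ - conj X.w * ⟪b', f⟫_ℂ + conj d * ⟪X.k, f⟫_ℂ := by
    intro f
    rw [← sB, X.C_C, X.inner_R_right, ← J_apply, hd, inner_add_left, inner_sub_left,
      inner_smul_left, inner_smul_left]
  have h3 : ∀ f, ⟪a', X.S (B (X.R f))⟫_ℂ = ⟪X.S (X.C (B (X.C (X.R a')))), f⟫_ℂ := by
    intro f
    rw [← X.inner_R, ← sB, X.inner_R_right]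
  refine ⟨A b - conj d • X.hat A a, X.S (X.C (B (X.C (X.R a')))) +
    conj ⟪a', X.k⟫_ℂ • b', fun f => ?_⟩
  have h4 := hA.apply_S (B (X.R f))
  have h5 := hB f
  have h6 : X.S (B (X.R f)) = B f - ⟪X.k, f⟫_ℂ • b - ⟪b', f⟫_ℂ • X.k := by
    rw [sub_eq_iff_eq_add.mp h5]; module
  rw [h2, h3, h6, map_sub, map_sub, map_smul, map_smul, hA.apply_k] at h4
  rw [mul_apply, mul_apply,
    inner_add_left, inner_smul_left, Complex.conj_conj]
  have h7 : X.S (A (B (X.R f))) = A (B f) - ⟪X.k, f⟫_ℂ • A b - ⟪b', f⟫_ℂ • (a -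
      conj X.w • X.hat A a + ⟪a', X.k⟫_ℂ • X.k) + (⟪X.J b, f⟫_ℂ - conj X.w * ⟪b', f⟫_ℂ +
      conj d * ⟪X.k, f⟫_ℂ) • X.hat A a - ⟪X.S (X.C (B (X.C (X.R a')))), f⟫_ℂ • X.k := by
    rw [h4]; abel
  rw [h7]
  module

end Defect

/-! ### Types, perturbed shifts, and the rigidity of products. -/

section Types

variable {X}
variable {A B T : K →L[ℂ] K} {a a' b b' : K}

/-- An operator whose form vanishes on the orthogonal complement of `k` is a sum `a ⊗ k + k ⊗ a'`.
In this form the condition is visibly closed in the weak operator topology. -/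
lemma exists_hasDefect [CompleteSpace K]
    (h : ∀ f g, ⟪X.k, f⟫_ℂ = 0 → ⟪X.k, g⟫_ℂ = 0 → ⟪g, T f - X.S (T (X.R f))⟫_ℂ = 0) :
    ∃ a a', X.HasDefect T a a' := by
  set D : K →L[ℂ] K := T - X.S ∘L T ∘L X.R with hD
  have hDf : ∀ f, D f = T f - X.S (T (X.R f)) := fun f => rfl
  set N := ⟪X.k, X.k⟫_ℂ with hN
  have hN0 : N ≠ 0 := X.inner_k_k_ne
  -- The row and the column of `D` through `k` both contain its `k ⊗ k` entry; the last term of `a`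
  -- removes the duplicate.
  refine ⟨N⁻¹ • D X.k - (⟪X.k, D X.k⟫_ℂ / N ^ 2) • X.k,
    conj N⁻¹ • ContinuousLinearMap.adjoint D X.k, fun f => ?_⟩
  have h1 : D (X.perp f) ∈ X.line := by
    refine X.mem_line_of_inner fun g hg => ?_
    rw [← inner_conj_symm, hDf, h _ _ (X.inner_k_perp f) hg, map_zero]
  obtain ⟨c, hc⟩ := Submodule.mem_span_singleton.mp h1
  have h2 := congrArg (fun x => ⟪X.k, x⟫_ℂ) hc
  rw [perp, map_sub, map_smul] at hc
  simp only [perp, map_sub, map_smul, inner_sub_right, inner_smul_right] at h2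
  rw [← hN] at hc h2
  rw [← hDf, inner_smul_left, Complex.conj_conj, ContinuousLinearMap.adjoint_inner_left]
  have h3 : c = N⁻¹ * ⟪X.k, D f⟫_ℂ - ⟪X.k, f⟫_ℂ * (⟪X.k, D X.k⟫_ℂ / N ^ 2) := by
    field_simp
    field_simp at h2
    linear_combination h2
  have h4 := eq_add_of_sub_eq hc.symm
  rw [h3] at h4
  refine h4.trans ?_
  module

lemma HasDefect.inner_eq_zero (h : X.HasDefect T a a') {f g : K} (hf : ⟪X.k, f⟫_ℂ = 0)
    (hg : ⟪X.k, g⟫_ℂ = 0) : ⟪g, T f - X.S (T (X.R f))⟫_ℂ = 0 := by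
  rw [h f, hf, inner_add_right, inner_smul_right, inner_smul_right, ← inner_conj_symm g X.k, hg]
  simp

variable (X) in
/-- The pair `(a, a')` of defect vectors is of type `α`. -/
def IsType : OnePoint ℂ → K → K → Prop
  | OnePoint.infty, a, _ => a ∈ X.line
  | OnePoint.some α, a, a' => a' - conj α • X.J a ∈ X.line

variable (X) in
/-- The rank one operator `k ⊗ C k`. -/
def rankOneKernel : K →L[ℂ] K := (innerSL ℂ (X.C X.k)).smulRight X.k

lemma rankOneKernel_apply (f : K) : X.rankOneKernel f = ⟪X.C X.k, f⟫_ℂ • X.k := rfl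

variable (X) in
/-- The rank one perturbation of (a multiple of) the compressed shift whose commutant contains the
operators of type `α`. -/
def perturbedShift : OnePoint ℂ → (K →L[ℂ] K)
  | OnePoint.infty => X.rankOneKernel - conj X.w • X.S
  | OnePoint.some α => (1 - α * conj X.w) • X.S + α • X.rankOneKernel

lemma perturbedShift_infty :
    X.perturbedShift OnePoint.infty = X.rankOneKernel - conj X.w • X.S := rfl

lemma perturbedShift_coe (α : ℂ) :
    X.perturbedShift α = (1 - α * conj X.w) • X.S + α • X.rankOneKernel := rfl

lemma isSymm_rankOneKernel : X.IsSymm X.rankOneKernel := fun f g => by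
  rw [rankOneKernel_apply, rankOneKernel_apply, map_smulₛₗ, inner_smul_left, inner_smul_right,
    Complex.conj_conj, X.inner_C_C, mul_comm]

lemma IsSymm.smul (hA : X.IsSymm A) (c : ℂ) : X.IsSymm (c • A) := fun f g => by
  rw [_root_.smul_apply, _root_.smul_apply, map_smulₛₗ, inner_smul_left,
    inner_smul_right, Complex.conj_conj, hA]

lemma IsSymm.add (hA : X.IsSymm A) (hB : X.IsSymm B) : X.IsSymm (A + B) := fun f g => by
  rw [_root_.add_apply, _root_.add_apply, map_add, inner_add_left,
    inner_add_right, hA, hB]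

lemma HasDefect.add (hA : X.HasDefect A a a') (hB : X.HasDefect B b b') :
    X.HasDefect (A + B) (a + b) (a' + b') := fun f => by
  have h1 := hA f
  have h2 := hB f
  simp only [_root_.add_apply, map_add, inner_add_left, smul_add, add_smul]
  rw [sub_eq_iff_eq_add.mp h1, sub_eq_iff_eq_add.mp h2]
  abel

lemma HasDefect.smul (hA : X.HasDefect A a a') (c : ℂ) :
    X.HasDefect (c • A) (c • a) (conj c • a') := fun f => by
  have h1 := hA f
  simp only [_root_.smul_apply, map_smul, inner_smul_left, Complex.conj_conj]
  rw [sub_eq_iff_eq_add.mp h1]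
  module

lemma hasDefect_S : X.HasDefect X.S (X.S X.k) 0 := fun f => by
  rw [X.S_R, map_sub, map_smul, inner_zero_left, zero_smul, add_zero, sub_sub_cancel]

lemma hasDefect_rankOneKernel :
    X.HasDefect X.rankOneKernel (conj X.w • X.S X.k) (X.C X.k) := fun f => by
  rw [rankOneKernel_apply, rankOneKernel_apply, X.inner_R_right, X.S_C_k, inner_neg_left,
    inner_smul_left, map_smul]
  module

lemma hasDefect_one : X.HasDefect 1 X.k 0 := fun f => by
  simp [X.S_R]

/-- The operator `perturbedShift α` is itself of type `α`. -/
lemma exists_hasDefect_perturbedShift (α : OnePoint ℂ) :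
    ∃ a a', X.HasDefect (X.perturbedShift α) a a' ∧ X.IsType α a a' ∧
      ((a ∈ X.line ∧ a' ∈ X.line) → X.S X.k ∈ X.line) := by
  induction α using OnePoint.rec with
  | infty =>
    refine ⟨0, X.C X.k, ?_, X.line.zero_mem, fun h => ?_⟩
    · convert (hasDefect_rankOneKernel (X := X)).add
        ((hasDefect_S (X := X)).smul (-conj X.w)) using 1
      · rw [perturbedShift_infty, neg_smul, sub_eq_add_neg]
      · module
      · simp
    · rw [← X.C_C X.k]
      exact X.J_mem h.2
  | coe α =>
    refine ⟨X.S X.k, conj α • X.C X.k, ?_, ?_, fun h => h.1⟩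
    · convert ((hasDefect_S (X := X)).smul (1 - α * conj X.w)).add
        ((hasDefect_rankOneKernel (X := X)).smul α) using 1
      · exact perturbedShift_coe α
      · module
      · simp
    -- Here `J (S k) = S S* C k`, which is `C k` modulo `k`.
    · change conj α • X.C X.k - conj α • X.J (X.S X.k) ∈ X.line
      rw [J_apply, X.C_S, X.S_R, smul_sub, sub_sub_cancel]
      exact X.line.smul_mem _ (X.smul_k_mem _)

/-- Type `α` in homogeneous coordinates. -/
lemma HasDefect.isType_iff (h : X.HasDefect T a a') (hT : X.IsSymm T) (α : ℂ) :
    X.IsType (OnePoint.some α) a a' ↔ α • a - X.hat T a ∈ X.line := by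
  change a' - conj α • X.J a ∈ X.line ↔ _
  have h1 : X.J (α • a - X.hat T a) + (a' - conj α • X.J a) ∈ X.line := by
    have h2 := X.J_mem (h.hat_sub_mem hT)
    rw [map_sub, J_J] at h2
    convert X.line.add_mem (X.line.neg_mem h2) (X.smul_k_mem ⟪X.k, a'⟫_ℂ) using 1
    rw [map_sub, map_smulₛₗ]
    module
  rw [← X.J_mem_iff (f := α • a - X.hat T a)]
  exact ⟨fun h3 => (Submodule.add_mem_iff_left _ h3).mp h1,
    fun h3 => (Submodule.add_mem_iff_right _ h3).mp h1⟩

/-- The commutator of a symmetric `T` with `t S + s k ⊗ C k`. -/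
lemma HasDefect.commutator (h : X.HasDefect T a a') (s t : ℂ) (f : K) :
    T ((t • X.S + s • X.rankOneKernel) f) - (t • X.S + s • X.rankOneKernel) (T f) =
      ⟪X.C X.k, f⟫_ℂ • (s • a - (t + s * conj X.w) • X.hat T a) +
      (t * ⟪a', X.S f⟫_ℂ + s * (⟪X.C X.k, f⟫_ℂ * ⟪a', X.k⟫_ℂ - ⟪X.C X.k, T f⟫_ℂ)) • X.k := by
  simp only [_root_.add_apply, _root_.smul_apply, rankOneKernel_apply,
    map_add, map_smul]
  rw [h.apply_S, h.apply_k]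
  module

/-- By `HasDefect.commutator` the stated vector is, modulo `k`, the value of the commutator at `C k`
divided by `⟪k, k⟫`. Conversely, if it lies in `line`, the commutator has range in `line`, and
skewness under `C` forces it to vanish. -/
lemma HasDefect.commute_iff (h : X.HasDefect T a a') (hT : X.IsSymm T) (s t : ℂ) :
    (∀ f, T ((t • X.S + s • X.rankOneKernel) f) = (t • X.S + s • X.rankOneKernel) (T f)) ↔
      s • a - (t + s * conj X.w) • X.hat T a ∈ X.line := by
  constructor
  · intro h1
    have h2 := h.commutator s t (X.C X.k)
    rw [h1, sub_self, X.inner_C_k_C_k] at h2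
    have h3 := X.line.neg_mem (X.smul_k_mem (t * ⟪a', X.S (X.C X.k)⟫_ℂ +
      s * (⟪X.k, X.k⟫_ℂ * ⟪a', X.k⟫_ℂ - ⟪X.C X.k, T (X.C X.k)⟫_ℂ)))
    rw [← eq_neg_of_add_eq_zero_left h2.symm] at h3
    exact (X.line.smul_mem_iff X.inner_k_k_ne).mp h3
  · intro h1 f
    set L := t • X.S + s • X.rankOneKernel with hL
    have hLs : X.IsSymm L := (isSymm_S.smul _).add (isSymm_rankOneKernel.smul _)
    have h2 : ∀ f, ∃ c : ℂ, c • X.k = T (L f) - L (T f) := fun f => by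
      rw [← Submodule.mem_span_singleton, h.commutator]
      exact X.line.add_mem (X.line.smul_mem _ h1) (X.smul_k_mem _)
    choose q hq using h2
    have h3 : ∀ f, q f * ⟪X.k, X.k⟫_ℂ = -(q (X.C X.k) * ⟪X.C f, X.k⟫_ℂ) := fun f => by
      have h4 := hT.commutator hLs f X.k
      rw [← hq, ← hq, inner_smul_right, inner_smul_right] at h4
      exact h4
    -- At `f = C k` the relation `h3` reads `q = -q`.
    have h5 : q (X.C X.k) = 0 := by
      have h6 := h3 (X.C X.k)
      rw [X.C_C] at h6
      have h7 : (2 * ⟪X.k, X.k⟫_ℂ) * q (X.C X.k) = 0 := by linear_combination h6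
      exact (mul_eq_zero.mp h7).resolve_left (mul_ne_zero two_ne_zero X.inner_k_k_ne)
    have h8 := h3 f
    rw [h5, zero_mul, neg_zero] at h8
    rw [← sub_eq_zero, ← hq, (mul_eq_zero.mp h8).resolve_right X.inner_k_k_ne, zero_smul]

/-- Operators of type `α` are characterized by commutation with `perturbedShift α`. -/
lemma HasDefect.commute_perturbedShift_iff (h : X.HasDefect T a a') (hT : X.IsSymm T)
    (α : OnePoint ℂ) : T * X.perturbedShift α = X.perturbedShift α * T ↔ X.IsType α a a' := by
  rw [ContinuousLinearMap.ext_iff]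
  simp only [mul_apply]
  induction α using OnePoint.rec with
  | infty =>
    have h1 : X.perturbedShift OnePoint.infty = (-conj X.w) • X.S + (1 : ℂ) • X.rankOneKernel := by
      rw [perturbedShift_infty]; module
    rw [h1, h.commute_iff hT]
    change _ ↔ a ∈ X.line
    simp
  | coe α =>
    have h2 := h.commute_iff hT α (1 - α * conj X.w)
    rw [sub_add_cancel, one_smul, ← h.isType_iff hT] at h2
    exact h2

/-- The product of two operators of the same type has a defect of rank at most two. -/
lemma HasDefect.mul_of_isType [CompleteSpace K] (hA : X.HasDefect A a a')
    (hB : X.HasDefect B b b') (sA : X.IsSymm A) (sB : X.IsSymm B) {α : OnePoint ℂ}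
    (tA : X.IsType α a a') (tB : X.IsType α b b') : ∃ c c', X.HasDefect (A * B) c c' := by
  refine exists_hasDefect fun f g hf hg => ?_
  obtain ⟨p, q, hpq⟩ := hA.mul hB sB
  rw [hpq f, hf]
  have hgk : ⟪g, X.k⟫_ℂ = 0 := by rw [← inner_conj_symm, hg, map_zero]
  have hline : ∀ x ∈ X.line, ⟪g, x⟫_ℂ = 0 := fun x hx => by
    rw [← inner_conj_symm, X.inner_eq_zero_of_mem_line hx hg, map_zero]
  simp only [inner_add_right, inner_sub_right, inner_smul_right, hgk]
  induction α using OnePoint.rec with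
  | infty =>
    rw [hline a tA, X.inner_eq_zero_of_mem_line (X.J_mem tB) hf]
    simp
  | coe α =>
    -- Against `g` the type of `A` replaces `hat A a` by `α a`, and against `f` the type of `B`
    -- replaces `b'` by `ᾱ J b`; the two remaining terms then cancel.
    have h1 := hline _ ((hA.isType_iff sA α).mp tA)
    have h2 := X.inner_eq_zero_of_mem_line tB hf
    rw [inner_sub_right, inner_smul_right] at h1
    rw [inner_sub_left, inner_smul_left, Complex.conj_conj] at h2
    linear_combination ⟪g, a⟫_ℂ * h2 + ⟪X.J b, f⟫_ℂ * h1

/-- A symmetric operator whose square has a defect of rank two has a type. -/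
lemma HasDefect.exists_isType (hA : X.HasDefect A a a') (sA : X.IsSymm A) {c c' : K}
    (hAA : X.HasDefect (A * A) c c') : ∃ α, X.IsType α a a' := by
  by_cases ha : a ∈ X.line
  · exact ⟨OnePoint.infty, ha⟩
  · obtain ⟨p, q, hpq⟩ := hA.mul hA sA
    have h1 : ∃ f, ⟪X.k, f⟫_ℂ = 0 ∧ ⟪X.J a, f⟫_ℂ ≠ 0 := by
      by_contra! h
      exact ha (X.J_mem_iff.mp (X.mem_line_of_inner h))
    obtain ⟨f, hf, hfa⟩ := h1
    -- At `f ⊥ k` the product formula for `A²` says `⟪a', f⟫ a - ⟪J a, f⟫ hat` is a multiple of `k`;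
    -- `α` is the ratio of these coefficients.
    refine ⟨OnePoint.some (⟪a', f⟫_ℂ / ⟪X.J a, f⟫_ℂ), ?_⟩
    rw [hA.isType_iff sA, ← X.line.smul_mem_iff hfa, smul_sub, smul_smul, mul_div_cancel₀ _ hfa]
    have h2 := (hpq f).symm.trans (hAA f)
    rw [hf, zero_smul, zero_smul, zero_add, add_zero] at h2
    rw [eq_sub_of_add_eq h2]
    exact X.line.sub_mem (X.smul_k_mem _) (X.smul_k_mem _)

/-- An operator whose product with a nonscalar operator of type `α` has a defect of rank two is of
type `α`. -/
lemma HasDefect.isType_of_mul (hA : X.HasDefect A a a') (hB : X.HasDefect B b b')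
    (sA : X.IsSymm A) (sB : X.IsSymm B) {c c' : K} (hAB : X.HasDefect (A * B) c c')
    (hA0 : ¬ (a ∈ X.line ∧ a' ∈ X.line)) {α : OnePoint ℂ} (tA : X.IsType α a a') :
    X.IsType α b b' := by
  obtain ⟨p, q, hpq⟩ := hA.mul hB sB
  have h1 : ∀ f, ⟪X.k, f⟫_ℂ = 0 → ⟪b', f⟫_ℂ • a - ⟪X.J b, f⟫_ℂ • X.hat A a ∈ X.line := by
    intro f hf
    have h2 := (hpq f).symm.trans (hAB f)
    rw [hf, zero_smul, zero_smul, zero_add, add_zero] at h2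
    rw [eq_sub_of_add_eq h2]
    exact X.line.sub_mem (X.smul_k_mem _) (X.smul_k_mem _)
  have hhat : X.hat A a ∈ X.line → a' ∈ X.line := fun h => by
    have h3 := X.line.sub_mem h (hA.hat_sub_mem sA)
    rw [sub_sub_cancel] at h3
    exact X.J_mem_iff.mp h3
  induction α using OnePoint.rec with
  | infty =>
    have ha : a ∈ X.line := tA
    refine X.J_mem_iff.mp (X.mem_line_of_inner fun f hf => ?_)
    by_contra hne
    have h4 := X.line.sub_mem (X.line.smul_mem ⟪b', f⟫_ℂ ha) (h1 f hf)
    rw [sub_sub_cancel, X.line.smul_mem_iff hne] at h4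
    exact hA0 ⟨ha, hhat h4⟩
  | coe α =>
    have h5 := (hA.isType_iff sA α).mp tA
    have ha : a ∉ X.line := fun ha => hA0 ⟨ha, hhat (by
      have h6 := X.line.sub_mem (X.line.smul_mem α ha) h5
      rwa [sub_sub_cancel] at h6)⟩
    refine X.mem_line_of_inner fun f hf => ?_
    by_contra hne
    have h7 := X.line.sub_mem (h1 f hf) (X.line.smul_mem ⟪X.J b, f⟫_ℂ h5)
    refine ha ((X.line.smul_mem_iff hne).mp ?_)
    convert h7 using 1
    rw [inner_sub_left, inner_smul_left, Complex.conj_conj]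
    module

/-- If `S k` is a multiple of `k`, the space is one-dimensional. -/
lemma mem_line_of_S_k_mem (h : X.S X.k ∈ X.line) (f : K) : f ∈ X.line := by
  obtain ⟨c, hc⟩ := Submodule.mem_span_singleton.mp h
  -- When `S k = c k`, a vector orthogonal to `k` is orthogonal to every `Sⁿ k`, so cyclicity kills
  -- it.
  have h1 : X.perp f = 0 := X.cyclic _ fun n => by
    induction n with
    | zero => exact X.inner_k_perp f
    | succ n ih =>
      rw [Function.iterate_succ_apply', X.inner_R_right, ← hc, inner_smul_left, ih, mul_zero]
  rw [perp, sub_eq_zero] at h1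
  exact h1 ▸ X.smul_k_mem _

end Types

end CompressedShift

/-! ### The model space as an abstract compressed shift. -/

section ModelSpace

variable {u : Linf}

lemma mem_modelSpace_iff {f : L2} :
    f ∈ modelSpace u ↔ f ∈ H2 ∧ ∀ n : ℤ, 0 ≤ n → ⟪e n, M (star u) f⟫_ℂ = 0 := by
  rw [modelSpace, Submodule.mem_inf, ← mem_H2_orthogonal_iff]
  refine and_congr_right fun _ => ⟨fun h y hy => ?_, ?_⟩
  · rw [← inner_M_left]
    exact h _ ⟨y, hy, rfl⟩
  · rintro h _ ⟨y, hy, rfl⟩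
    rw [← M_apply, inner_M_left]
    exact h y hy

/-- The inner product on the model space, as a shortcut instance. -/
instance innerModelSpace (u : Linf) : Inner ℂ (modelSpace u) := InnerProductSpace.toInner

lemma coe_inner (f g : modelSpace u) : ⟪f, g⟫_ℂ = ⟪(f : L2), (g : L2)⟫_ℂ := rfl

lemma conj_inner (f g : modelSpace u) : conj ⟪f, g⟫_ℂ = ⟪g, f⟫_ℂ := inner_conj_symm _ _

lemma inner_P (f : modelSpace u) (x : L2) : ⟪f, P u x⟫_ℂ = ⟪(f : L2), x⟫_ℂ :=
  Submodule.inner_orthogonalProjectionOnto_eq_of_mem_left f x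

lemma inner_P_left (f : modelSpace u) (x : L2) : ⟪P u x, f⟫_ℂ = ⟪x, (f : L2)⟫_ℂ := by
  rw [← conj_inner, inner_P, inner_conj_symm]

lemma P_coe (f : modelSpace u) : P u (f : L2) = f :=
  Submodule.orthogonalProjectionOnto_mem_subspace_eq_self f

lemma P_eq_zero_of_coeff {x : L2} (hx : ∀ n : ℤ, 0 ≤ n → ⟪e n, x⟫_ℂ = 0) : P u x = 0 := by
  refine ext_inner_left ℂ fun f => ?_
  rw [inner_P, inner_zero_right, ← inner_conj_symm, inner_eq_zero_of_mem_H2 hx f.2.1, map_zero]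

lemma P_M_u {h : L2} (hh : h ∈ H2) : P u (M u h) = 0 := by
  refine ext_inner_left ℂ fun f => ?_
  rw [inner_P, inner_zero_right, ← inner_conj_symm]
  rw [show ⟪M u h, (f : L2)⟫_ℂ = 0 from f.2.2 _ ⟨h, hh, rfl⟩, map_zero]

variable (u) in
/-- The compressed shift. -/
def shift : modelSpace u →L[ℂ] modelSpace u := P u ∘L M z ∘L (modelSpace u).subtypeL

variable (u) in
/-- The backward shift on the model space, the adjoint of the compressed shift. -/
def backwardShift : modelSpace u →L[ℂ] modelSpace u :=
  P u ∘L M (star z) ∘L (modelSpace u).subtypeL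

lemma shift_apply (f : modelSpace u) : shift u f = P u (M z f) := rfl

lemma backwardShift_apply (f : modelSpace u) : backwardShift u f = P u (M (star z) f) := rfl

lemma inner_e_neg_M_u (hu : IsInner u) {n : ℤ} (hn : n < 0) : ⟪e n, M u (e 0)⟫_ℂ = 0 := by
  rw [← fourierCoeff_Linf, hu.coeff_eq_zero n hn]

lemma M_u_e_zero_mem_H2 (hu : IsInner u) : M u (e 0) ∈ H2 :=
  mem_H2_iff.mpr fun _ => inner_e_neg_M_u hu

lemma inner_e_M_star_u (n : ℤ) : ⟪e n, M (star u) (e 0)⟫_ℂ = conj ⟪e (-n), M u (e 0)⟫_ℂ := by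
  rw [← inner_e_star, star_M, star_e, neg_zero]

/-- The function `z̄ (f - f(0))` already lies in `K_u`, and the projection annihilates `z̄`. -/
lemma coe_backwardShift (hu : IsInner u) (f : modelSpace u) :
    (backwardShift u f : L2) = M (star z) f - ⟪e 0, (f : L2)⟫_ℂ • e (-1) := by
  have hf := mem_modelSpace_iff.mp f.2
  have hmem : M (star z) (f : L2) - ⟪e 0, (f : L2)⟫_ℂ • e (-1) ∈ modelSpace u := by
    refine mem_modelSpace_iff.mpr ⟨mem_H2_iff.mpr fun n hn => ?_, fun n hn => ?_⟩
    · rw [inner_sub_right, inner_smul_right, inner_e_M_star_z, inner_e_e]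
      rcases eq_or_ne n (-1) with rfl | h
      · simp
      · rw [if_neg h, mem_H2_iff.mp hf.1 (n + 1) (by omega)]; simp
    · have h1 : e (-1) = M (star z) (e 0) := by rw [M_star_z_e]; rfl
      rw [h1, map_sub, map_smul, M_comm, M_comm (star u) (star z), inner_sub_right,
        inner_smul_right, inner_e_M_star_z, inner_e_M_star_z, hf.2 _ (by omega),
        inner_e_M_star_u, inner_e_neg_M_u hu (by omega)]
      simp
  have h2 : P u (M (star z) (f : L2)) =
      ⟨M (star z) (f : L2) - ⟪e 0, (f : L2)⟫_ℂ • e (-1), hmem⟩ := by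
    rw [← P_coe ⟨_, hmem⟩]
    change _ = P u (M (star z) (f : L2) - ⟪e 0, (f : L2)⟫_ℂ • e (-1))
    rw [map_sub, map_smul, P_eq_zero_of_coeff (x := e (-1)), smul_zero, sub_zero]
    intro n hn
    rw [inner_e_e, if_neg (by omega)]
  rw [backwardShift_apply, h2]

lemma C_eq (f : L2) : C u f = M u (M (star z) (star f)) := by
  rw [← star_M]; rfl

lemma C_mem (hu : IsInner u) (f : modelSpace u) : C u f ∈ modelSpace u := by
  have hf := mem_modelSpace_iff.mp f.2
  refine mem_modelSpace_iff.mpr ⟨mem_H2_iff.mpr fun n hn => ?_, fun n hn => ?_⟩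
  · have h : C u f = star (M z (M (star u) f)) := by
      rw [C_eq, star_M, star_M, star_star, M_comm]
    rw [h, inner_e_star, inner_e_M_z, hf.2 _ (by omega), map_zero]
  · rw [C_eq, M_star_M hu.norm_eq_one, ← star_M, inner_e_star, inner_e_M_z,
      mem_H2_iff.mp hf.1 _ (by omega), map_zero]

/-- The conjugation of the model space, as an antilinear map. -/
def conjugation (hu : IsInner u) : modelSpace u →ₗ⋆[ℂ] modelSpace u where
  toFun f := ⟨C u f, C_mem hu f⟩
  map_add' f g := Subtype.ext <| by
    simp only [Submodule.coe_add, C_eq, star_add_L2, map_add]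
  map_smul' c f := Subtype.ext <| by
    simp only [Submodule.coe_smul, C_eq, star_smul_L2, map_smul]

lemma coe_conjugation (hu : IsInner u) (f : modelSpace u) :
    (conjugation hu f : L2) = M u (M (star z) (star (f : L2))) := C_eq _

variable (u) in
/-- The reproducing kernel at the origin. -/
def kernel : modelSpace u := P u (e 0)

lemma inner_kernel (f : modelSpace u) : ⟪kernel u, f⟫_ℂ = ⟪e 0, (f : L2)⟫_ℂ := inner_P_left f _

lemma coe_kernel (hu : IsInner u) :
    (kernel u : L2) = e 0 - conj ⟪e 0, M u (e 0)⟫_ℂ • M u (e 0) := by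
  have hmem : e 0 - conj ⟪e 0, M u (e 0)⟫_ℂ • M u (e 0) ∈ modelSpace u := by
    refine mem_modelSpace_iff.mpr ⟨H2.sub_mem (e_mem_H2 le_rfl)
      (H2.smul_mem _ (M_u_e_zero_mem_H2 hu)), fun n hn => ?_⟩
    rw [map_sub, map_smul, M_star_M hu.norm_eq_one, inner_sub_right, inner_smul_right, inner_e_e,
      inner_e_M_star_u]
    rcases hn.eq_or_lt with rfl | h
    · simp
    · rw [if_neg (by omega), inner_e_neg_M_u hu (by omega)]; simp
  have h2 : P u (e 0) = ⟨e 0 - conj ⟪e 0, M u (e 0)⟫_ℂ • M u (e 0), hmem⟩ := by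
    rw [← P_coe ⟨_, hmem⟩]
    change _ = P u (e 0 - conj ⟪e 0, M u (e 0)⟫_ℂ • M u (e 0))
    rw [map_sub, map_smul, P_M_u (e_mem_H2 le_rfl), smul_zero, sub_zero]
  rw [kernel, h2]

/-- As `k = 1 - conj w • u`, a vanishing kernel would make `u` constant. -/
lemma kernel_ne_zero (hu : IsInner u) (hnc : ¬ IsConstant u) : kernel u ≠ 0 := by
  intro h
  have h1 := coe_kernel hu
  rw [h, Submodule.coe_zero, eq_comm, sub_eq_zero] at h1
  set c := conj ⟪e 0, M u (e 0)⟫_ℂ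
  refine hnc ⟨c⁻¹, ?_⟩
  have hc : c ≠ 0 := by
    intro hc
    have h2 := inner_e_e 0 0
    rw [hc, zero_smul] at h1
    rw [h1] at h2
    simp at h2
  have h3 : M u (e 0) = c⁻¹ • e 0 := by rw [eq_inv_smul_iff₀ hc, ← h1]
  have h4 := M_e_zero_ae u
  rw [h3] at h4
  filter_upwards [h4, Lp.coeFn_smul c⁻¹ (e 0), coeFn_fourierLp (T := 1) 2 0] with t ht h5 h6
  rw [← ht, h5, Pi.smul_apply, h6, fourier_zero]; simp

lemma conjugation_conjugation (hu : IsInner u) (f : modelSpace u) :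
    conjugation hu (conjugation hu f) = f := Subtype.ext <| by
  rw [coe_conjugation, coe_conjugation, star_M, star_M, star_star, star_star,
    M_comm (star z) (star u), M_M_star hu.norm_eq_one, M_star_M norm_z]

lemma inner_conjugation_conjugation (hu : IsInner u) (f g : modelSpace u) :
    ⟪conjugation hu f, conjugation hu g⟫_ℂ = ⟪g, f⟫_ℂ := by
  rw [coe_inner, coe_conjugation, coe_conjugation, inner_M_left, M_star_M hu.norm_eq_one,
    inner_M_left, M_star_M, inner_star_star, coe_inner]
  filter_upwards [norm_z, ae_star z] with t h1 h2
  rw [h2, RCLike.norm_conj, h1]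

lemma inner_backwardShift (f g : modelSpace u) :
    ⟪backwardShift u f, g⟫_ℂ = ⟪f, shift u g⟫_ℂ := by
  rw [shift_apply, backwardShift_apply, inner_P, inner_P_left, inner_M_left, star_star]

lemma inner_coe_iterate_backwardShift (hu : IsInner u) (g : modelSpace u) (n : ℕ) :
    ∀ m : ℤ, 0 ≤ m → ⟪e m, ((backwardShift u)^[n] g : L2)⟫_ℂ = ⟪e (m + n), (g : L2)⟫_ℂ := by
  induction n with
  | zero => simp
  | succ n ih =>
    intro m hm
    rw [Function.iterate_succ_apply', coe_backwardShift hu, inner_sub_right, inner_smul_right,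
      inner_e_e, if_neg (by omega), mul_zero, sub_zero, inner_e_M_star_z, ih _ (by omega)]
    push_cast
    congr 2; ring

/-- The model space as an instance of the abstract structure. -/
def model (hu : IsInner u) (hnc : ¬ IsConstant u) : CompressedShift (modelSpace u) where
  S := shift u
  R := backwardShift u
  C := conjugation hu
  k := kernel u
  w := ⟪e 0, M u (e 0)⟫_ℂ
  inner_R := inner_backwardShift
  C_C := conjugation_conjugation hu
  inner_C_C := inner_conjugation_conjugation hu
  C_S f := by
    refine ext_inner_left ℂ fun g => ?_
    have h1 : ⟪g, conjugation hu (shift u f)⟫_ℂ = ⟪shift u f, conjugation hu g⟫_ℂ := by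
      rw [← inner_conjugation_conjugation hu, conjugation_conjugation]
    have h2 : ⟪g, backwardShift u (conjugation hu f)⟫_ℂ = ⟪shift u g, conjugation hu f⟫_ℂ := by
      rw [← conj_inner, inner_backwardShift, conj_inner]
    rw [h1, h2, shift_apply, shift_apply, inner_P_left, inner_P_left, coe_conjugation,
      coe_conjugation, ← inner_star_star, star_M, star_M, star_M, star_star, star_star, inner_M_left,
      star_star]
  S_R f := by
    rw [shift_apply, coe_backwardShift hu, map_sub, map_smul, M_z_e, M_M_star norm_z, map_sub,
      map_smul, P_coe, inner_kernel]
    rfl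
  R_k := by
    refine Subtype.ext ?_
    rw [coe_backwardShift hu, Submodule.coe_neg, Submodule.coe_smul, coe_conjugation,
      coe_kernel hu]
    set w := ⟪e 0, M u (e 0)⟫_ℂ with hw
    have h1 : star (e 0 - conj w • M u (e 0)) = e 0 - w • M (star u) (e 0) := by
      rw [sub_eq_add_neg, ← neg_smul, star_add_L2, star_smul_L2, star_M, star_e, map_neg,
        Complex.conj_conj, neg_smul, neg_zero, ← sub_eq_add_neg]
    rw [h1, inner_sub_right, inner_smul_right, ← hw, inner_e_e, if_pos rfl]
    simp only [map_sub, map_smul]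
    rw [M_comm u (star z), M_comm u (star z), M_M_star hu.norm_eq_one, M_star_z_e, zero_sub]
    module
  k_ne := kernel_ne_zero hu hnc
  cyclic g hg := by
    refine Subtype.ext (eq_zero_of_coeff fun n => ?_)
    rcases le_or_gt 0 n with hn | hn
    · obtain ⟨m, rfl⟩ := Int.eq_ofNat_of_zero_le hn
      have h := hg m
      rw [inner_kernel, inner_coe_iterate_backwardShift hu _ _ _ le_rfl, zero_add] at h
      exact h
    · exact mem_H2_iff.mp g.2.1 n hn

/-- Each backward shift differs from multiplication by `z̄` only by a multiple of `z̄`, which is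
invisible to `H²`. -/
lemma inner_coe_iterate_backwardShift_of_mem_H2 (hu : IsInner u) (g : modelSpace u) (n : ℕ) :
    ∀ y ∈ H2, ⟪((backwardShift u)^[n] g : L2), y⟫_ℂ = ⟪(g : L2), (M z)^[n] y⟫_ℂ := by
  induction n with
  | zero => simp
  | succ n ih =>
    intro y hy
    rw [Function.iterate_succ_apply', coe_backwardShift hu, inner_sub_left, inner_smul_left,
      mem_H2_iff.mp hy _ (by norm_num), mul_zero, sub_zero, inner_M_left, star_star,
      ih _ (M_z_mem_H2 hy), Function.iterate_succ_apply]

lemma norm_sq_iterate_backwardShift (hu : IsInner u) (f : modelSpace u) (n : ℕ) :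
    ‖(backwardShift u)^[n] f‖ ^ 2 = ‖f‖ ^ 2 - ∑ j ∈ Finset.range n, ‖⟪e j, (f : L2)⟫_ℂ‖ ^ 2 := by
  induction n with
  | zero => simp
  | succ n ih =>
    rw [Finset.sum_range_succ, ← sub_sub, ← ih, Function.iterate_succ_apply']
    set g := (backwardShift u)^[n] f with hg
    have h0 : ⟪e 0, (g : L2)⟫_ℂ = ⟪e n, (f : L2)⟫_ℂ := by
      rw [hg, inner_coe_iterate_backwardShift hu _ _ _ le_rfl, zero_add]
    have h1 : shift u (backwardShift u g) = g - ⟪e 0, (g : L2)⟫_ℂ • kernel u := by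
      rw [shift_apply, coe_backwardShift hu, map_sub, map_smul, M_z_e, M_M_star norm_z, map_sub,
        map_smul, P_coe]
      rfl
    have h2 : ((‖backwardShift u g‖ ^ 2 : ℝ) : ℂ) = ((‖g‖ ^ 2 - ‖⟪e n, (f : L2)⟫_ℂ‖ ^ 2 : ℝ) : ℂ) := by
      have h3 : ⟪g, kernel u⟫_ℂ = conj ⟪e 0, (g : L2)⟫_ℂ := by rw [← inner_kernel, conj_inner]
      have h4 := inner_backwardShift g (backwardShift u g)
      rw [h1, coe_inner g, Submodule.coe_sub, Submodule.coe_smul, inner_sub_right,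
        inner_smul_right, ← coe_inner, ← coe_inner, h3, h0, Complex.mul_conj',
        show ⟪g, g⟫_ℂ = ((‖g‖ : ℂ)) ^ 2 from inner_self_eq_norm_sq_to_K g,
        show ⟪backwardShift u g, backwardShift u g⟫_ℂ = ((‖backwardShift u g‖ : ℂ)) ^ 2 from
          inner_self_eq_norm_sq_to_K _] at h4
      push_cast
      exact h4
    exact Complex.ofReal_injective h2

/-- The squared norm of `S*ⁿ f` is the tail of the convergent Parseval series of `f`. -/
lemma tendsto_norm_iterate_backwardShift (hu : IsInner u) (f : modelSpace u) :
    Filter.Tendsto (fun n => ‖(backwardShift u)^[n] f‖) Filter.atTop (nhds 0) := by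
  have h1 : HasSum (fun n : ℕ => ‖⟪e n, (f : L2)⟫_ℂ‖ ^ 2) (‖f‖ ^ 2) := by
    refine (Function.Injective.hasSum_iff (f := fun n : ℤ => ‖⟪e n, (f : L2)⟫_ℂ‖ ^ 2)
      (g := ((↑) : ℕ → ℤ)) Nat.cast_injective fun n hn => ?_).mpr (hasSum_norm_coeff (f : L2))
    have hn' : n < 0 := by
      by_contra! h
      obtain ⟨m, rfl⟩ := Int.eq_ofNat_of_zero_le h
      exact hn ⟨m, rfl⟩
    rw [mem_H2_iff.mp f.2.1 n hn']; simp
  have h2 : Filter.Tendsto (fun n => ‖(backwardShift u)^[n] f‖ ^ 2) Filter.atTop (nhds 0) := by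
    simp only [norm_sq_iterate_backwardShift hu]
    rw [← sub_self (‖f‖ ^ 2)]
    exact h1.tendsto_sum_nat.const_sub (‖f‖ ^ 2)
  simpa using h2.sqrt

end ModelSpace

/-! ### Symbols versus defects: Sarason's criterion and complex symmetry. -/

section Symbols

variable {u : Linf}

lemma inner_smul_right_model (c : ℂ) (f g : modelSpace u) : ⟪f, c • g⟫_ℂ = c * ⟪f, g⟫_ℂ :=
  inner_smul_right (f : L2) (g : L2) c

lemma inner_smul_left_model (c : ℂ) (f g : modelSpace u) : ⟪c • f, g⟫_ℂ = conj c * ⟪f, g⟫_ℂ :=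
  inner_smul_left (f : L2) (g : L2) c

variable (u) in
/-- The bounded functions in the model space. -/
def boundedVectors : Submodule ℂ (modelSpace u) where
  carrier := {f | ∃ a : Linf, M a (e 0) = (f : L2)}
  zero_mem' := ⟨0, Lp.zero_smul ℂ ⊤ (e 0)⟩
  add_mem' := by
    rintro f g ⟨a, ha⟩ ⟨b, hb⟩
    exact ⟨a + b, (Lp.smul_add a b (e 0)).trans (by
      rw [← M_apply, ← M_apply, ha, hb, Submodule.coe_add])⟩
  smul_mem' := by
    rintro c f ⟨a, ha⟩
    exact ⟨c • a, by rw [M_const_smul, ha, Submodule.coe_smul]⟩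

/-- If `a` represents a bounded `f`, this represents `S* f`. -/
def backwardSymbol (a : Linf) : Linf :=
  (star z • (a - ⟪e 0, M a (e 0)⟫_ℂ • fourierLp ⊤ 0 : Linf) : Linf)

lemma M_backwardSymbol (a : Linf) (x : L2) :
    M (backwardSymbol a) x = M (star z) (M a x - ⟪e 0, M a (e 0)⟫_ℂ • x) := by
  rw [backwardSymbol, M_smul, M_sub, M_const_smul, M_fourierLp_zero]

lemma M_backwardSymbol_e_zero (hu : IsInner u) {a : Linf} {f : modelSpace u}
    (ha : M a (e 0) = (f : L2)) : M (backwardSymbol a) (e 0) = (backwardShift u f : L2) := by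
  rw [M_backwardSymbol, coe_backwardShift hu, map_sub, map_smul, M_star_z_e, ha, zero_sub]

lemma M_conjugation_e_zero (hu : IsInner u) {a : Linf} {f : modelSpace u}
    (ha : M a (e 0) = (f : L2)) :
    M (u • (star z • star a : Linf) : Linf) (e 0) = (conjugation hu f : L2) := by
  rw [M_smul, M_smul, coe_conjugation, ← ha, star_M, star_e, neg_zero]

/-- Boundedness is clear for `k`, for `C f` and for `S* f = z̄ (f - f(0))`; it passes to `S f`
because `S = C S* C`. -/
lemma iterate_shift_mem_boundedVectors (hu : IsInner u) (hnc : ¬ IsConstant u) (n : ℕ) :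
    (shift u)^[n] (kernel u) ∈ boundedVectors u := by
  induction n with
  | zero =>
    refine ⟨fourierLp ⊤ 0 - conj ⟪e 0, M u (e 0)⟫_ℂ • u, ?_⟩
    rw [Function.iterate_zero, id, coe_kernel hu, M_sub, M_const_smul, M_fourierLp_zero]
  | succ n ih =>
    rw [Function.iterate_succ_apply']
    obtain ⟨a, ha⟩ := ih
    have h := (model hu hnc).C_R (conjugation hu ((shift u)^[n] (kernel u)))
    have h1 : shift u ((shift u)^[n] (kernel u)) =
        conjugation hu (backwardShift u (conjugation hu ((shift u)^[n] (kernel u)))) := by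
      refine Eq.trans ?_ h.symm
      change _ = shift u (conjugation hu (conjugation hu _))
      rw [conjugation_conjugation]
    rw [h1]
    exact ⟨_, M_conjugation_e_zero hu (M_backwardSymbol_e_zero hu (M_conjugation_e_zero hu ha))⟩

/-- The bounded vectors `Sⁿ k` are total: pairing with `Sⁿ k` reads off the `n`-th Fourier
coefficient. -/
lemma dense_boundedVectors (hu : IsInner u) (hnc : ¬ IsConstant u) :
    Dense (boundedVectors u : Set (modelSpace u)) := by
  rw [Submodule.dense_iff_topologicalClosure_eq_top, Submodule.topologicalClosure_eq_top_iff,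
    Submodule.eq_bot_iff]
  intro g hg
  refine (model hu hnc).cyclic g fun n => ?_
  change ⟪kernel u, (backwardShift u)^[n] g⟫_ℂ = 0
  have h1 : ∀ (n : ℕ) (f g : modelSpace u),
      ⟪f, (backwardShift u)^[n] g⟫_ℂ = ⟪(shift u)^[n] f, g⟫_ℂ := by
    intro n
    induction n with
    | zero => simp
    | succ n ih =>
      intro f g
      rw [Function.iterate_succ_apply', Function.iterate_succ_apply, ← ih, ← conj_inner,
        inner_backwardShift, conj_inner]
  rw [h1]
  exact hg _ (iterate_shift_mem_boundedVectors hu hnc n)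

lemma ext_bounded (hu : IsInner u) (hnc : ¬ IsConstant u) {x y : modelSpace u}
    (h : ∀ (g : modelSpace u) (b : Linf), M b (e 0) = (g : L2) → ⟪g, x⟫_ℂ = ⟪g, y⟫_ℂ) : x = y :=
  (dense_boundedVectors hu hnc).eq_of_inner_right ℂ fun v hv => by
    obtain ⟨b, hb⟩ := hv
    exact h v b hb

/-- The sesquilinear form of the symbol `φ + ψ̄`. -/
def symbolForm (φ ψ : L2) (a b : Linf) : ℂ := ⟪M b (e 0), M a φ⟫_ℂ + ⟪M b ψ, M a (e 0)⟫_ℂ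

lemma hasSymbol_iff (hu : IsInner u) (hnc : ¬ IsConstant u) (A : Op u) (φ ψ : L2) :
    HasSymbol u A (φ + star ψ) ↔ ∀ (f : modelSpace u) (a : Linf), M a (e 0) = (f : L2) →
      ∀ (g : modelSpace u) (b : Linf), M b (e 0) = (g : L2) → ⟪g, A f⟫_ℂ = symbolForm φ ψ a b := by
  have key : ∀ (a b : Linf) (g : modelSpace u), M b (e 0) = (g : L2) →
      ⟪g, P u (M a (φ + star ψ))⟫_ℂ = symbolForm φ ψ a b := fun a b g hb => by
    rw [inner_P, map_add, inner_add_right, ← hb, inner_M_star, symbolForm]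
  constructor
  · intro h f a ha g b hb
    rw [h f a ((ae_eq_iff_M_e_zero a f).mpr ha), ← M_apply, key a b g hb]
  · intro h f a ha
    refine ext_bounded hu hnc fun g b hb => ?_
    rw [← M_apply, key a b g hb, h f a ((ae_eq_iff_M_e_zero a f).mp ha) g b hb]

lemma inner_backwardShift_M_backwardSymbol (hu : IsInner u) {φ : L2} (hφ : φ ∈ H2)
    {f : modelSpace u} {a : Linf} (ha : M a (e 0) = (f : L2)) (g : modelSpace u) :
    ⟪(backwardShift u g : L2), M (backwardSymbol a) φ⟫_ℂ =
      ⟪(g : L2), M a φ⟫_ℂ - ⟪e 0, (f : L2)⟫_ℂ * ⟪(g : L2), φ⟫_ℂ := by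
  have h1 : M (backwardSymbol a) φ ∈ H2 := M_mem_H2 (by
    rw [M_backwardSymbol_e_zero hu ha]; exact (backwardShift u f).2.1) hφ
  have h2 := inner_coe_iterate_backwardShift_of_mem_H2 hu g 1 _ h1
  rw [Function.iterate_one, Function.iterate_one] at h2
  rw [h2, M_backwardSymbol, M_M_star norm_z, inner_sub_right, inner_smul_right, ha]

/-- This is the defect identity at the level of the symbol. For the analytic part, `S*` on `g`
becomes multiplication by `z` on the other side and undoes the `z̄` in `S* f`, leaving only the
correction by `f(0)`; the part with `ψ` is the same with the roles of `f` and `g` exchanged. -/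
lemma symbolForm_backward (hu : IsInner u) {φ ψ : L2} (hφ : φ ∈ H2) (hψ : ψ ∈ H2)
    {f g : modelSpace u} {a b : Linf} (ha : M a (e 0) = (f : L2)) (hb : M b (e 0) = (g : L2)) :
    symbolForm φ ψ (backwardSymbol a) (backwardSymbol b) = symbolForm φ ψ a b -
      (⟪kernel u, f⟫_ℂ * ⟪g, P u φ⟫_ℂ + ⟪P u ψ, f⟫_ℂ * ⟪g, kernel u⟫_ℂ) := by
  have h1 := inner_backwardShift_M_backwardSymbol hu hφ ha g
  have h2 := congrArg conj (inner_backwardShift_M_backwardSymbol hu hψ hb f)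
  simp only [map_sub, map_mul, inner_conj_symm] at h2
  rw [symbolForm, symbolForm, M_backwardSymbol_e_zero hu ha, M_backwardSymbol_e_zero hu hb, h1, h2,
    ha, hb, inner_P, inner_P_left, inner_kernel, ← conj_inner (kernel u) g, inner_kernel, inner_conj_symm]
  ring

lemma exists_iterate_M_z_M (a : Linf) (n : ℕ) : ∃ c : Linf, ∀ x, (M z)^[n] (M a x) = M c x := by
  induction n with
  | zero => exact ⟨a, fun x => rfl⟩
  | succ n ih =>
    obtain ⟨c, hc⟩ := ih
    exact ⟨(z • c : Linf), fun x => by rw [Function.iterate_succ_apply', hc, M_smul]⟩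

lemma norm_M_z (x : L2) : ‖M z x‖ = ‖x‖ := by
  have h : ⟪M z x, M z x⟫_ℂ = ⟪x, x⟫_ℂ := by rw [inner_M_left, M_star_M norm_z]
  rw [inner_self_eq_norm_sq_to_K, inner_self_eq_norm_sq_to_K] at h
  exact (sq_eq_sq₀ (norm_nonneg _) (norm_nonneg _)).mp (by exact_mod_cast h)

lemma norm_iterate_M_z (x : L2) (n : ℕ) : ‖(M z)^[n] x‖ = ‖x‖ := by
  induction n with
  | zero => rfl
  | succ n ih => rw [Function.iterate_succ_apply', norm_M_z, ih]

/-- Moving `φ` onto the bounded function `b` gives a bound with a factor independent of `n`, while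
`zⁿ` acts isometrically on `f`. Applied to `S*ⁿ f`, it makes the symbol form tend to zero along
iterates. -/
lemma norm_inner_iterate_le (hu : IsInner u) {φ : L2} (hφ : φ ∈ H2) {f g : modelSpace u}
    {a b : Linf} (ha : M a (e 0) = (f : L2)) (hb : M b (e 0) = (g : L2)) (n : ℕ) :
    ‖⟪((backwardShift u)^[n] g : L2), M a φ⟫_ℂ‖ ≤ ‖M b (star φ)‖ * ‖f‖ := by
  have h1 : M a φ ∈ H2 := M_mem_H2 (by rw [ha]; exact f.2.1) hφ
  obtain ⟨c, hc⟩ := exists_iterate_M_z_M a n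
  rw [inner_coe_iterate_backwardShift_of_mem_H2 hu g n _ h1, hc, ← hb, inner_M_star', ← hc]
  refine (norm_inner_le_norm _ _).trans ?_
  rw [norm_iterate_M_z, ha]
  rfl

lemma iterate_backwardSymbol_e_zero (hu : IsInner u) {f : modelSpace u} {a : Linf}
    (ha : M a (e 0) = (f : L2)) (n : ℕ) :
    M (backwardSymbol^[n] a) (e 0) = ((backwardShift u)^[n] f : L2) := by
  induction n with
  | zero => exact ha
  | succ n ih =>
    rw [Function.iterate_succ_apply', Function.iterate_succ_apply', M_backwardSymbol_e_zero hu ih]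

/-- Sarason's characterization: a bounded operator has symbol `φ + ψ̄` with `φ, ψ ∈ H²` if and only
if its defect `A - S A S*` is `P φ ⊗ k + k ⊗ P ψ`. -/
theorem hasSymbol_iff_hasDefect (hu : IsInner u) (hnc : ¬ IsConstant u) (A : Op u) {φ ψ : L2}
    (hφ : φ ∈ H2) (hψ : ψ ∈ H2) :
    HasSymbol u A (φ + star ψ) ↔ (model hu hnc).HasDefect A (P u φ) (P u ψ) := by
  rw [hasSymbol_iff hu hnc]
  have expand : ∀ f g : modelSpace u, ⟪g, ⟪kernel u, f⟫_ℂ • P u φ + ⟪P u ψ, f⟫_ℂ • kernel u⟫_ℂ =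
      ⟪kernel u, f⟫_ℂ * ⟪g, P u φ⟫_ℂ + ⟪P u ψ, f⟫_ℂ * ⟪g, kernel u⟫_ℂ := fun f g => by
    rw [inner_add_right, inner_smul_right_model, inner_smul_right_model]
  have expand' : ∀ f g : modelSpace u, ⟪g, A f - shift u (A (backwardShift u f))⟫_ℂ =
      ⟪g, A f⟫_ℂ - ⟪backwardShift u g, A (backwardShift u f)⟫_ℂ := fun f g => by
    rw [inner_sub_right, inner_backwardShift]
  constructor
  · intro h f
    change A f - shift u (A (backwardShift u f)) =
      ⟪kernel u, f⟫_ℂ • P u φ + ⟪P u ψ, f⟫_ℂ • kernel u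
    have hc1 : Continuous fun f => A f - shift u (A (backwardShift u f)) := by fun_prop
    have hc2 : Continuous fun f : modelSpace u =>
        ⟪kernel u, f⟫_ℂ • P u φ + ⟪P u ψ, f⟫_ℂ • kernel u :=
      ((innerSL ℂ (kernel u)).continuous.smul continuous_const).add
        ((innerSL ℂ (P u ψ)).continuous.smul continuous_const)
    refine congrFun (hc1.ext_on (dense_boundedVectors hu hnc) hc2 ?_) f
    rintro f ⟨a, ha⟩
    refine ext_bounded hu hnc fun g b hb => ?_
    rw [expand, expand', h f a ha g b hb, h _ _ (M_backwardSymbol_e_zero hu ha) _ _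
      (M_backwardSymbol_e_zero hu hb), symbolForm_backward hu hφ hψ ha hb]
    ring
  · intro h f a ha g b hb
    -- The operator form and the symbol form change by the same amount under the backward shift in
    -- both variables, so their difference is invariant; `hbound` and `hlim` show that it is zero.
    have hstep : ∀ n : ℕ, ⟪g, A f⟫_ℂ - symbolForm φ ψ a b =
        ⟪(backwardShift u)^[n] g, A ((backwardShift u)^[n] f)⟫_ℂ -
          symbolForm φ ψ (backwardSymbol^[n] a) (backwardSymbol^[n] b) := by
      intro n
      induction n with
      | zero => rfl
      | succ n ih =>
        have h1 : A _ - shift u (A _) = _ := h ((backwardShift u)^[n] f)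
        have h2 := expand' ((backwardShift u)^[n] f) ((backwardShift u)^[n] g)
        have h3 := expand ((backwardShift u)^[n] f) ((backwardShift u)^[n] g)
        have h4 := (congrArg (fun x => ⟪(backwardShift u)^[n] g, x⟫_ℂ) h1).symm.trans h2
        have h5 := h3.symm.trans h4
        rw [ih, Function.iterate_succ_apply', Function.iterate_succ_apply',
          Function.iterate_succ_apply', Function.iterate_succ_apply',
          symbolForm_backward hu hφ hψ (iterate_backwardSymbol_e_zero hu ha n)
            (iterate_backwardSymbol_e_zero hu hb n), h5]
        ring
    have hbound : ∀ n : ℕ, ‖⟪g, A f⟫_ℂ - symbolForm φ ψ a b‖ ≤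
        ‖(backwardShift u)^[n] g‖ * (‖A‖ * ‖(backwardShift u)^[n] f‖) +
          (‖M b (star φ)‖ * ‖(backwardShift u)^[n] f‖ +
            ‖M a (star ψ)‖ * ‖(backwardShift u)^[n] g‖) := by
      intro n
      have ha' := iterate_backwardSymbol_e_zero hu ha n
      have hb' := iterate_backwardSymbol_e_zero hu hb n
      rw [hstep n]
      refine (norm_sub_le _ _).trans (add_le_add ?_ ?_)
      · exact (norm_inner_le_norm (𝕜 := ℂ) _ _).trans
          (mul_le_mul_of_nonneg_left (A.le_opNorm _) (norm_nonneg _))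
      · rw [symbolForm]
        refine (norm_add_le _ _).trans (add_le_add ?_ ?_)
        · rw [hb']
          exact norm_inner_iterate_le hu hφ ha' hb n
        · rw [ha', norm_inner_symm]
          exact norm_inner_iterate_le hu hψ hb' ha n
    have hlim : Filter.Tendsto (fun n : ℕ => ‖(backwardShift u)^[n] g‖ *
        (‖A‖ * ‖(backwardShift u)^[n] f‖) + (‖M b (star φ)‖ * ‖(backwardShift u)^[n] f‖ +
            ‖M a (star ψ)‖ * ‖(backwardShift u)^[n] g‖)) Filter.atTop (nhds 0) := by
      have hf := tendsto_norm_iterate_backwardShift hu f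
      have hg := tendsto_norm_iterate_backwardShift hu g
      simpa using (hg.mul (hf.const_mul ‖A‖)).add
        ((hf.const_mul ‖M b (star φ)‖).add (hg.const_mul ‖M a (star ψ)‖))
    have h0 := ge_of_tendsto' hlim hbound
    exact sub_eq_zero.mp (norm_le_zero_iff.mp h0)

/-- The bounded truncated Toeplitz operators are the operators with a defect `a ⊗ k + k ⊗ a'`. -/
theorem mem_boundedTTO_iff (hu : IsInner u) (hnc : ¬ IsConstant u) (A : Op u) :
    A ∈ boundedTTO u ↔ ∃ a a', (model hu hnc).HasDefect A a a' := by
  constructor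
  · rintro ⟨Φ, hΦ⟩
    obtain ⟨φ, hφ, ψ, hψ, rfl⟩ := exists_analytic_add_antianalytic Φ
    exact ⟨_, _, (hasSymbol_iff_hasDefect hu hnc A hφ hψ).mp hΦ⟩
  · rintro ⟨a, a', h⟩
    refine ⟨a + star (a' : L2), (hasSymbol_iff_hasDefect hu hnc A a.2.1 a'.2.1).mpr ?_⟩
    rwa [P_coe, P_coe]

lemma continuous_conjugation (hu : IsInner u) : Continuous (conjugation hu) := by
  refine (AddMonoidHomClass.isometry_of_norm (conjugation hu) fun f => ?_).continuous
  have h := inner_conjugation_conjugation hu f f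
  rw [show ⟪f, f⟫_ℂ = (‖f‖ : ℂ) ^ 2 from inner_self_eq_norm_sq_to_K f,
    show ⟪conjugation hu f, conjugation hu f⟫_ℂ = (‖conjugation hu f‖ : ℂ) ^ 2 from
      inner_self_eq_norm_sq_to_K _] at h
  exact (sq_eq_sq₀ (norm_nonneg _) (norm_nonneg _)).mp (by exact_mod_cast h)

/-- Truncated Toeplitz operators are complex symmetric. -/
theorem isSymm_of_mem_boundedTTO (hu : IsInner u) (hnc : ¬ IsConstant u) {A : Op u}
    (hA : A ∈ boundedTTO u) : (model hu hnc).IsSymm A := by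
  obtain ⟨Φ, hΦ⟩ := hA
  have hCc := continuous_conjugation hu
  -- For bounded vectors this is a direct computation with the symbol, the unimodular factors `u`
  -- and `z` cancelling. It is then extended by density in one variable at a time.
  have h1 : ∀ f g : modelSpace u, f ∈ boundedVectors u → g ∈ boundedVectors u →
      ⟪conjugation hu (A (conjugation hu f)), g⟫_ℂ = ⟪f, A g⟫_ℂ := by
    rintro f g ⟨a, ha⟩ ⟨b, hb⟩
    have h2 := (model hu hnc).inner_C_left (A (conjugation hu f)) g
    refine h2.trans ?_
    change ⟪conjugation hu g, A (conjugation hu f)⟫_ℂ = _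
    rw [hΦ _ _ ((ae_eq_iff_M_e_zero _ _).mpr (M_conjugation_e_zero hu ha)),
      hΦ _ _ ((ae_eq_iff_M_e_zero _ _).mpr hb), inner_P, inner_P, ← M_apply, ← M_apply,
      ← M_conjugation_e_zero hu hb, ← ha]
    simp only [M_smul]
    rw [inner_M_left, M_star_M hu.norm_eq_one, inner_M_left, star_star, M_M_star norm_z,
      inner_M_left, star_star, M_comm, inner_M_left]
  have h2 : ∀ g, g ∈ boundedVectors u → ∀ f,
      ⟪conjugation hu (A (conjugation hu f)), g⟫_ℂ = ⟪f, A g⟫_ℂ := fun g hg f => by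
    have hc1 : Continuous fun f => ⟪conjugation hu (A (conjugation hu f)), g⟫_ℂ :=
      (hCc.comp (A.continuous.comp hCc)).inner continuous_const
    have hc2 : Continuous fun f => ⟪f, A g⟫_ℂ := continuous_id.inner continuous_const
    exact congrFun (hc1.ext_on (dense_boundedVectors hu hnc) hc2 fun f hf => h1 f g hf hg) f
  intro f g
  have hc1 : Continuous fun g => ⟪conjugation hu (A (conjugation hu f)), g⟫_ℂ :=
    continuous_const.inner continuous_id
  have hc2 : Continuous fun g => ⟪f, A g⟫_ℂ := continuous_const.inner A.continuous
  exact congrFun (hc1.ext_on (dense_boundedVectors hu hnc) hc2 fun g hg => h2 g hg f) g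

/-- `B_α` in terms of defects. -/
theorem mem_typeSet_iff (hu : IsInner u) (hnc : ¬ IsConstant u) (α : OnePoint ℂ) (A : Op u) :
    A ∈ typeSet u α ↔
      ∃ a a', (model hu hnc).HasDefect A a a' ∧ (model hu hnc).IsType α a a' := by
  induction α using OnePoint.rec with
  | infty =>
    constructor
    · rintro ⟨ψ, hψ, h⟩
      rw [← zero_add (star ψ), hasSymbol_iff_hasDefect hu hnc A H2.zero_mem hψ, map_zero] at h
      exact ⟨_, _, h, Submodule.zero_mem _⟩
    · rintro ⟨a, a', h, ha⟩
      obtain ⟨c, rfl⟩ := Submodule.mem_span_singleton.mp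
        (show a ∈ Submodule.span ℂ {kernel u} from ha)
      -- The term `c (k ⊗ k)` from `a = c k` moves to the second slot by adding the constant `conj
      -- c` to `ψ`.
      have hψ : (a' : L2) + conj c • e 0 ∈ H2 :=
        H2.add_mem a'.2.1 (H2.smul_mem _ (e_mem_H2 le_rfl))
      refine ⟨(a' : L2) + conj c • e 0, hψ, ?_⟩
      rw [← zero_add (star _), hasSymbol_iff_hasDefect hu hnc A H2.zero_mem hψ, map_zero, map_add,
        map_smul, P_coe]
      intro f
      refine (h f).trans ?_
      change ⟪kernel u, f⟫_ℂ • c • kernel u + ⟪a', f⟫_ℂ • kernel u =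
        ⟪kernel u, f⟫_ℂ • (0 : modelSpace u) + ⟪a' + conj c • kernel u, f⟫_ℂ • kernel u
      rw [inner_add_left, inner_smul_left_model, Complex.conj_conj]
      module
  | coe α =>
    have key : ∀ (φ : modelSpace u) (c : ℂ),
        HasSymbol u A ((φ : L2) + α • star (SC u φ : L2) + Lp.const 2 haarAddCircle c) ↔
        (model hu hnc).HasDefect A φ (conj α • (model hu hnc).J φ + conj c • kernel u) := by
      intro φ c
      have hψ : conj α • (SC u φ : L2) + conj c • e 0 ∈ H2 :=
        H2.add_mem (H2.smul_mem _ (SC u φ).2.1) (H2.smul_mem _ (e_mem_H2 le_rfl))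
      have h1 := hasSymbol_iff_hasDefect hu hnc A φ.2.1 hψ
      rw [star_add_L2, star_smul_L2, star_smul_L2, star_e, neg_zero, Complex.conj_conj,
        Complex.conj_conj, ← const_eq_smul_e, ← add_assoc, map_add, map_smul, map_smul, P_coe,
        P_coe] at h1
      exact h1
    constructor
    · rintro ⟨φ, c, h⟩
      refine ⟨_, _, (key φ c).mp h, ?_⟩
      change _ + _ - _ ∈ (model hu hnc).line
      rw [add_sub_cancel_left]
      exact (model hu hnc).smul_k_mem _
    · rintro ⟨a, a', h, ha⟩
      obtain ⟨c, hc⟩ := Submodule.mem_span_singleton.mp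
        (show a' - conj α • (model hu hnc).J a ∈ Submodule.span ℂ {kernel u} from ha)
      refine ⟨a, conj c, (key a (conj c)).mpr ?_⟩
      rw [Complex.conj_conj, hc, add_sub_cancel]
      exact h

end Symbols

/-! ### The algebras `B_α`: closure, exhaustion and incomparability. -/

section Algebras

variable {u : Linf}

/-- `B_α` consists of the truncated Toeplitz operators that commute with `perturbedShift α`. -/
theorem mem_typeSet_iff_commute (hu : IsInner u) (hnc : ¬ IsConstant u) (α : OnePoint ℂ)
    (A : Op u) : A ∈ typeSet u α ↔ A ∈ boundedTTO u ∧
      A * (model hu hnc).perturbedShift α = (model hu hnc).perturbedShift α * A := by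
  rw [mem_typeSet_iff hu hnc]
  constructor
  · rintro ⟨a, a', h, ht⟩
    have hA := (mem_boundedTTO_iff hu hnc A).mpr ⟨a, a', h⟩
    exact ⟨hA, (h.commute_perturbedShift_iff (isSymm_of_mem_boundedTTO hu hnc hA) α).mpr ht⟩
  · rintro ⟨hA, hc⟩
    obtain ⟨a, a', h⟩ := (mem_boundedTTO_iff hu hnc A).mp hA
    exact ⟨a, a', h, (h.commute_perturbedShift_iff (isSymm_of_mem_boundedTTO hu hnc hA) α).mp hc⟩

lemma typeSet_subset_boundedTTO (hu : IsInner u) (hnc : ¬ IsConstant u) (α : OnePoint ℂ) :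
    typeSet u α ⊆ boundedTTO u := fun A hA => ((mem_typeSet_iff_commute hu hnc α A).mp hA).1

lemma add_mem_boundedTTO (hu : IsInner u) (hnc : ¬ IsConstant u) {A B : Op u}
    (hA : A ∈ boundedTTO u) (hB : B ∈ boundedTTO u) : A + B ∈ boundedTTO u := by
  rw [mem_boundedTTO_iff hu hnc] at *
  obtain ⟨a, a', ha⟩ := hA
  obtain ⟨b, b', hb⟩ := hB
  exact ⟨_, _, ha.add hb⟩

lemma smul_one_mem_boundedTTO (hu : IsInner u) (hnc : ¬ IsConstant u) (c : ℂ) :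
    c • (1 : Op u) ∈ boundedTTO u :=
  (mem_boundedTTO_iff hu hnc _).mpr
    ⟨_, _, (CompressedShift.hasDefect_one (X := model hu hnc)).smul c⟩

lemma mul_mem_boundedTTO (hu : IsInner u) (hnc : ¬ IsConstant u) {α : OnePoint ℂ} {A B : Op u}
    (hA : A ∈ typeSet u α) (hB : B ∈ typeSet u α) : A * B ∈ boundedTTO u := by
  have sA := isSymm_of_mem_boundedTTO hu hnc (typeSet_subset_boundedTTO hu hnc α hA)
  have sB := isSymm_of_mem_boundedTTO hu hnc (typeSet_subset_boundedTTO hu hnc α hB)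
  obtain ⟨a, a', ha, tA⟩ := (mem_typeSet_iff hu hnc α A).mp hA
  obtain ⟨b, b', hb, tB⟩ := (mem_typeSet_iff hu hnc α B).mp hB
  exact (mem_boundedTTO_iff hu hnc _).mpr (ha.mul_of_isType hb sA sB tA tB)

/-- `B_α` as a unital algebra. -/
def typeAlgebra (hu : IsInner u) (hnc : ¬ IsConstant u) (α : OnePoint ℂ) :
    Subalgebra ℂ (Op u) where
  carrier := typeSet u α
  mul_mem' {A B} hA hB := by
    have hAB := mul_mem_boundedTTO hu hnc hA hB
    rw [mem_typeSet_iff_commute hu hnc] at *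
    exact ⟨hAB, (show Commute A _ from hA.2).mul_left hB.2⟩
  add_mem' {A B} hA hB := by
    rw [mem_typeSet_iff_commute hu hnc] at *
    exact ⟨add_mem_boundedTTO hu hnc hA.1 hB.1, (show Commute A _ from hA.2).add_left hB.2⟩
  algebraMap_mem' c := by
    rw [mem_typeSet_iff_commute hu hnc, Algebra.algebraMap_eq_smul_one]
    exact ⟨smul_one_mem_boundedTTO hu hnc c, (Commute.one_left _).smul_left c⟩

/-- Both the vanishing of the defect form on vectors orthogonal to `k` and commutation with a fixed
operator are equations between matrix entries `⟪g, T f⟫`, hence weakly closed. -/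
lemma isClosed_typeSet (hu : IsInner u) (hnc : ¬ IsConstant u) (α : OnePoint ℂ) :
    IsClosed {T : modelSpace u →WOT[ℂ] modelSpace u | T.toCLM ∈ typeSet u α} := by
  have hcont : ∀ f g : modelSpace u,
      Continuous fun T : modelSpace u →WOT[ℂ] modelSpace u => ⟪g, T f⟫_ℂ := fun f g =>
    ContinuousLinearMapWOT.continuous_dual_apply f (innerSL ℂ g)
  set L := (model hu hnc).perturbedShift α
  have h : {T : modelSpace u →WOT[ℂ] modelSpace u | T.toCLM ∈ typeSet u α} =
      (⋂ f : modelSpace u, ⋂ g : modelSpace u, ⋂ _ : ⟪kernel u, f⟫_ℂ = 0,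
        ⋂ _ : ⟪kernel u, g⟫_ℂ = 0, {T | ⟪g, T f⟫_ℂ -
          ⟪backwardShift u g, T (backwardShift u f)⟫_ℂ = 0}) ∩
      ⋂ f : modelSpace u, ⋂ g : modelSpace u,
        {T | ⟪g, T (L f)⟫_ℂ = ⟪ContinuousLinearMap.adjoint L g, T f⟫_ℂ} := by
    ext T
    have hsub : ∀ f g : modelSpace u, ⟪g, T f - shift u (T (backwardShift u f))⟫_ℂ =
        ⟪g, T f⟫_ℂ - ⟪backwardShift u g, T (backwardShift u f)⟫_ℂ := fun f g => by
      rw [inner_sub_right, inner_backwardShift]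
    have hadj : ∀ f g : modelSpace u, ⟪ContinuousLinearMap.adjoint L g, T f⟫_ℂ = ⟪g, L (T f)⟫_ℂ :=
      fun f g => ContinuousLinearMap.adjoint_inner_left L _ _
    simp only [Set.mem_inter_iff, Set.mem_iInter, Set.mem_ofPred_eq, hadj, ← hsub]
    rw [mem_typeSet_iff_commute hu hnc, mem_boundedTTO_iff hu hnc]
    refine and_congr ⟨?_, fun h1 => ?_⟩ ⟨fun h2 f g => ?_, fun h2 => ?_⟩
    · rintro ⟨a, a', ha⟩ f g hf hg
      exact ha.inner_eq_zero hf hg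
    · exact CompressedShift.exists_hasDefect h1
    · exact congrArg (fun x => ⟪g, x⟫_ℂ) (ContinuousLinearMap.ext_iff.mp h2 f)
    · ext1 f
      exact ext_inner_left ℂ fun g => h2 f g
  rw [h]
  refine IsClosed.inter ?_ ?_
  · exact isClosed_iInter fun f => isClosed_iInter fun g => isClosed_iInter fun _ =>
      isClosed_iInter fun _ => isClosed_eq ((hcont _ _).sub (hcont _ _)) continuous_const
  · exact isClosed_iInter fun f => isClosed_iInter fun g => isClosed_eq (hcont _ _) (hcont _ _)

/-- Operators with `A B` truncated Toeplitz, where `A` is nonscalar of type `α`, are of type `α`. -/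
lemma mem_typeSet_of_mul_mem (hu : IsInner u) (hnc : ¬ IsConstant u) {A B : Op u}
    (hA : A ∈ boundedTTO u) (hB : B ∈ boundedTTO u) (hAB : A * B ∈ boundedTTO u)
    {a a' : modelSpace u} (ha : (model hu hnc).HasDefect A a a')
    (hne : ¬ (a ∈ (model hu hnc).line ∧ a' ∈ (model hu hnc).line)) {α : OnePoint ℂ}
    (tA : (model hu hnc).IsType α a a') : B ∈ typeSet u α := by
  have sA := isSymm_of_mem_boundedTTO hu hnc hA
  have sB := isSymm_of_mem_boundedTTO hu hnc hB
  obtain ⟨b, b', hb⟩ := (mem_boundedTTO_iff hu hnc B).mp hB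
  obtain ⟨c, c', hc⟩ := (mem_boundedTTO_iff hu hnc _).mp hAB
  exact (mem_typeSet_iff hu hnc α B).mpr ⟨b, b', hb, ha.isType_of_mul hb sA sB hc hne tA⟩

/-- Every algebra of truncated Toeplitz operators is contained in some `B_α`. -/
theorem exists_subset_typeSet (hu : IsInner u) (hnc : ¬ IsConstant u)
    (𝒜 : NonUnitalSubalgebra ℂ (Op u)) (h𝒜 : (𝒜 : Set (Op u)) ⊆ boundedTTO u) :
    ∃ α : OnePoint ℂ, (𝒜 : Set (Op u)) ⊆ typeSet u α := by
  by_cases h : ∃ A ∈ 𝒜, ∃ a a', (model hu hnc).HasDefect A a a' ∧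
      ¬ (a ∈ (model hu hnc).line ∧ a' ∈ (model hu hnc).line)
  · obtain ⟨A, hA, a, a', ha, hne⟩ := h
    obtain ⟨c, c', hc⟩ := (mem_boundedTTO_iff hu hnc _).mp (h𝒜 (𝒜.mul_mem hA hA))
    obtain ⟨α, hα⟩ := ha.exists_isType (isSymm_of_mem_boundedTTO hu hnc (h𝒜 hA)) hc
    exact ⟨α, fun B hB => mem_typeSet_of_mul_mem hu hnc (h𝒜 hA) (h𝒜 hB)
      (h𝒜 (𝒜.mul_mem hA hB)) ha hne hα⟩
  · push Not at h
    -- With all defect vectors in `line`, every type would do.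
    refine ⟨OnePoint.infty, fun A hA => ?_⟩
    obtain ⟨a, a', ha⟩ := (mem_boundedTTO_iff hu hnc A).mp (h𝒜 hA)
    exact (mem_typeSet_iff hu hnc _ A).mpr ⟨a, a', ha, (h A hA a a' ha).1⟩

/-- There are no proper inclusions among the `B_α`. -/
theorem typeSet_subset_of_subset (hu : IsInner u) (hnc : ¬ IsConstant u) {α β : OnePoint ℂ}
    (h : typeSet u α ⊆ typeSet u β) : typeSet u β ⊆ typeSet u α := by
  intro B hB
  have hB' := typeSet_subset_boundedTTO hu hnc β hB
  obtain ⟨a, a', ha, ht, himp⟩ :=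
    CompressedShift.exists_hasDefect_perturbedShift (X := model hu hnc) α
  by_cases hne : a ∈ (model hu hnc).line ∧ a' ∈ (model hu hnc).line
  · obtain ⟨b, b', hb⟩ := (mem_boundedTTO_iff hu hnc B).mp hB'
    refine (mem_typeSet_iff hu hnc α B).mpr ⟨b, b', hb, ?_⟩
    -- In this degenerate case `K_u` is one-dimensional, and every operator has every type.
    have hall := (model hu hnc).mem_line_of_S_k_mem (himp hne)
    induction α using OnePoint.rec with
    | infty => exact hall _
    | coe α => exact hall _
  · have hA : (model hu hnc).perturbedShift α ∈ typeSet u α :=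
      (mem_typeSet_iff hu hnc α _).mpr ⟨a, a', ha, ht⟩
    -- The perturbed shift of type `α` also lies in `B_β`, so its product with `B` is truncated
    -- Toeplitz, which forces type `α` on `B`.
    exact mem_typeSet_of_mul_mem hu hnc (typeSet_subset_boundedTTO hu hnc α hA) hB'
      (mul_mem_boundedTTO hu hnc (h hA) hB) ha hne ht

end Algebras

end TTO

end

/-! ### The main theorem. -/

theorem mainTheorem2 (u : TTO.Linf) (hu : TTO.IsInner u) (hnc : ¬ TTO.IsConstant u) :
    -- each `B_α` is a commutative, weakly closed algebra of bounded truncated Toeplitz operators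
    (∀ α : OnePoint ℂ, ∃ B : Subalgebra ℂ (TTO.Op u),
      (B : Set (TTO.Op u)) = TTO.typeSet u α ∧
      (B : Set (TTO.Op u)) ⊆ TTO.boundedTTO u ∧
      (∀ A ∈ B, ∀ A' ∈ B, A * A' = A' * A) ∧
      IsClosed {T : TTO.modelSpace u →WOT[ℂ] TTO.modelSpace u | T.toCLM ∈ B}) ∧
    -- every algebra of bounded truncated Toeplitz operators lies in some `B_α`
    (∀ 𝒜 : NonUnitalSubalgebra ℂ (TTO.Op u), (𝒜 : Set (TTO.Op u)) ⊆ TTO.boundedTTO u →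
      ∃ α : OnePoint ℂ, (𝒜 : Set (TTO.Op u)) ⊆ TTO.typeSet u α) ∧
    -- the `B_α` are exactly the maximal algebras of bounded truncated Toeplitz operators
    (∀ 𝒜 : NonUnitalSubalgebra ℂ (TTO.Op u),
      Maximal (fun 𝒜' : NonUnitalSubalgebra ℂ (TTO.Op u) =>
        (𝒜' : Set (TTO.Op u)) ⊆ TTO.boundedTTO u) 𝒜 ↔
      ∃ α : OnePoint ℂ, (𝒜 : Set (TTO.Op u)) = TTO.typeSet u α) := by
  refine ⟨fun α => ⟨TTO.typeAlgebra hu hnc α, rfl, TTO.typeSet_subset_boundedTTO hu hnc α,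
    fun A hA A' hA' => ?_, TTO.isClosed_typeSet hu hnc α⟩,
    TTO.exists_subset_typeSet hu hnc, fun 𝒜 => ⟨fun h => ?_, ?_⟩⟩
  · have hsub := TTO.typeSet_subset_boundedTTO hu hnc α
    have sA := TTO.isSymm_of_mem_boundedTTO hu hnc (hsub hA)
    have sA' := TTO.isSymm_of_mem_boundedTTO hu hnc (hsub hA')
    exact sA.commute sA'
      (TTO.isSymm_of_mem_boundedTTO hu hnc (TTO.mul_mem_boundedTTO hu hnc hA hA'))
  · obtain ⟨α, hα⟩ := TTO.exists_subset_typeSet hu hnc 𝒜 h.prop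
    refine ⟨α, hα.antisymm ?_⟩
    have hle : 𝒜 ≤ (TTO.typeAlgebra hu hnc α).toNonUnitalSubalgebra := hα
    exact h.le_of_ge (TTO.typeSet_subset_boundedTTO hu hnc α) hle
  · rintro ⟨α, hα⟩
    refine ⟨?_, fun 𝒜' h𝒜' hle => ?_⟩
    · change (𝒜 : Set (TTO.Op u)) ⊆ _
      rw [hα]
      exact TTO.typeSet_subset_boundedTTO hu hnc α
    · obtain ⟨β, hβ⟩ := TTO.exists_subset_typeSet hu hnc 𝒜' h𝒜'
      -- A larger algebra lies in some `B_β`, which then contains `B_α`; incomparability makes all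
      -- three equal.
      have h1 : TTO.typeSet u α ⊆ TTO.typeSet u β := hα ▸ (Set.Subset.trans hle hβ)
      intro A hA
      have h2 := TTO.typeSet_subset_of_subset hu hnc h1 (hβ hA)
      rw [← hα] at h2
      exact h2
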